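/- Let $d\ge 1$ be an integer. For real $s\ge 0$ let $H^s(\mathbf R^d,\mathbf C)$ be the space of those $f\in L^2(\mathbf R^d,\mathbf C)$ for which $\|f\|_s:=\big\|(1+|k|^2)^{s/2}\,\mathcal F f\big\|_{L^2}$ is finite, where $\mathcal F f(k)=(2\pi)^{-d/2}\int e^{-ik\cdot x}f(x)\,dx$. For real $0\le\ell\le m\le n$ with $m+n-\ell>d/2$ let $K_{\ell m n d}$ be the least $K\ge 0$ such that $fg\in H^\ell$ and $\|fg\|_\ell\le K\|f\|_m\|g\|_n$ for all $f\in H^m$, $g\in H^n$. Put $$\mathscr S_{\ell m n d}(u)=\frac{\Gamma(m+n-\frac d2)}{(4\pi)^{d/2}\,\Gamma(m+n)}\,(1+4u)^{\ell}\;{}_3F_2\Big(m+n-\tfrac d2,\,m,\,n;\ \tfrac{m+n}{2},\,\tfrac{m+n+1}{2};\ -u\Big)\quad(u\ge 0),\qquad K^{\mathscr S}_{\ell m n d}=\sqrt{\sup_{u\ge 0}\mathscr S_{\ell m n d}(u)},$$ where, for $\alpha>0$ and $w<1$, ${}_3F_2$ is continued beyond its power series by $${}_3F_2(\alpha,\beta,\gamma;\delta,\epsilon;w)=\frac1{\Gamma(\alpha)}\int_0^\infty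 e^{-t}t^{\alpha-1}\,{}_2F_2(\beta,\gamma;\delta,\epsilon;wt)\,dt .$$ For $b,c\ge 1$ let $$\Sigma_{bcd\ell}(u)=(1+4u)^\ell\,{}_3F_2\Big((b+c)\ell-\tfrac d2,\,b\ell,\,c\ell;\ \tfrac{(b+c)\ell}{2},\,\tfrac{(b+c)\ell+1}{2};\ -u\Big),$$ and say that condition $\mathfrak S_{bcd}$ holds if $\sup_{u\ge 0}\Sigma_{bcd\ell}(u)$ is finite for all large $\ell$ and equals $1+O(1/\ell)$ as $\ell\to+\infty$. With $f_\sigma(x)=e^{-\sigma|x|^2/2}$ let $$\mathscr K^F_{\ell m n d}(\sigma,\tau)=\frac{\|f_{\sigma+\tau}\|_\ell}{\|f_\sigma\|_m\,\|f_\tau\|_n}\qquad(\sigma,\tau>0),$$ and let $$D_{22}(\xi,\eta)=\frac{(1-\xi-\eta)(\xi+\eta)}{\xi\eta(1-2\xi)(1-2\eta)}\quad\text{on}\quad \Delta_{22}=\{(\xi,\eta)\in(0,\tfrac12)^2:\ \xi+\eta<1\}.$$ Then the following holds. (0) For every real $\ell>d/6$ the least constant $K_{\ell,2\ell,2\ell,d}$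 exists, $\mathscr S_{\ell,2\ell,2\ell,d}$ is bounded above on $[0,+\infty)$, and $$\mathscr K^F_{\ell,2\ell,2\ell,d}\big(\tfrac1{4\ell},\tfrac1{4\ell}\big)\ \le\ K_{\ell,2\ell,2\ell,d}\ \le\ K^{\mathscr S}_{\ell,2\ell,2\ell,d}.$$ (i) Condition $\mathfrak S_{22d}$ holds, and $K^{\mathscr S}_{\ell,2\ell,2\ell,d}=\dfrac{1+O(1/\ell)}{(16\pi\ell)^{d/4}}$ as $\ell\to+\infty$. (ii) $D_{22}$ attains its minimum over $\Delta_{22}$ at $\xi=\eta=\frac14$, with $D_{22}(\frac14,\frac14)=16$, and $\mathscr K^F_{\ell,2\ell,2\ell,d}\big(\tfrac1{4\ell},\tfrac1{4\ell}\big)=\dfrac{1+O(1/\ell)}{(16\pi\ell)^{d/4}}$ as $\ell\to+\infty$. (iii) $K_{\ell,2\ell,2\ell,d}=\dfrac{1+O(1/\ell)}{(16\pi\ell)^{d/4}}$ as $\ell\to+\infty$. Here $\ell$ tends to $+\infty$ through the reals, and the implied constants may depend on $d$. -/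

import Mathlib

open Set Filter MeasureTheory Asymptotics
open scoped FourierTransform ENNReal

noncomputable section

/-- `ℝᵈ` with its Euclidean norm and Lebesgue measure. -/
abbrev Rd (d : ℕ) : Type := EuclideanSpace ℝ (Fin d)

/-- The unitary Fourier transform of a square integrable function, normalised so that
`𝓕f(k) = (2π)^(-d/2) ∫ e^(-i k•x) f(x) dx`. Mathlib's `𝓕` on `L²` has kernel `e^(-2πi ξ•x)`,
hence the dilation `ξ = k / 2π` and the factor. (Value `0` if `f` is not in `L²`.) -/
def fourierL2 {d : ℕ} (f : Rd d → ℂ) (k : Rd d) : ℂ :=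
  open Classical in
  if hf : MemLp f 2 volume then
    (((2 * Real.pi) ^ (-(d : ℝ) / 2) : ℝ) : ℂ) *
      (𝓕 (hf.toLp f) : Lp ℂ 2 (volume : Measure (Rd d))) ((2 * Real.pi)⁻¹ • k)
  else 0

/-- The function `k ↦ √(1 + |k|²)^s · 𝓕f(k)`. -/
def weightedFourier {d : ℕ} (s : ℝ) (f : Rd d → ℂ) (k : Rd d) : ℂ :=
  ((Real.sqrt (1 + ‖k‖ ^ 2) ^ s : ℝ) : ℂ) * fourierL2 f k

/-- `f ∈ H^s(ℝᵈ, ℂ)` for an order `s ≥ 0` (so that `H^s ⊆ L²` consists of ordinary functions). -/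
def InSobolev {d : ℕ} (s : ℝ) (f : Rd d → ℂ) : Prop :=
  MemLp f 2 volume ∧ MemLp (weightedFourier s f) 2 volume

/-- The norm `‖f‖_s = ‖√(1 + |k|²)^s 𝓕f‖_{L²}` of `f ∈ H^s(ℝᵈ, ℂ)`. -/
def sobolevNorm {d : ℕ} (s : ℝ) (f : Rd d → ℂ) : ℝ :=
  (eLpNorm (weightedFourier s f) 2 volume).toReal

/-- The constants `K ≥ 0` with `‖fg‖_ℓ ≤ K ‖f‖_m ‖g‖_n` for all `f ∈ H^m`, `g ∈ H^n`
(including the assertion that `fg ∈ H^ℓ`). -/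
def multConstants (l m n : ℝ) (d : ℕ) : Set ℝ :=
  {K | 0 ≤ K ∧ ∀ f g : Rd d → ℂ, InSobolev m f → InSobolev n g →
    InSobolev l (fun x => f x * g x) ∧
      sobolevNorm l (fun x => f x * g x) ≤ K * sobolevNorm m f * sobolevNorm n g}

/-- The sharp constant `K_{ℓmnd}`. -/
def sharpK (l m n : ℝ) (d : ℕ) : ℝ := sInf (multConstants l m n d)

/-- The Pochhammer symbol `(a)_k = a (a+1) ⋯ (a+k-1)`. -/
def poch (a : ℝ) (k : ℕ) : ℝ := (ascPochhammer ℝ k).eval a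

/-- The (everywhere convergent) series `₂F₂(α, β; δ, ε; w)`. -/
def hyp2F2 (α β δ ε w : ℝ) : ℝ :=
  ∑' k : ℕ, poch α k * poch β k / (poch δ k * poch ε k) * (w ^ k / (Nat.factorial k : ℝ))

/-- `₃F₂(α, β, γ; δ, ε; w)` for `α > 0` and `w < 1`, where the hypergeometric series need not
converge: the standard continuation by the integral
`(1/Γ(α)) ∫₀^∞ e^(-t) t^(α-1) ₂F₂(β, γ; δ, ε; w t) dt`. -/
def hyp3F2 (α β γ δ ε w : ℝ) : ℝ :=
  1 / Real.Gamma α *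
    ∫ t in Ioi (0 : ℝ), Real.exp (-t) * t ^ (α - 1) * hyp2F2 β γ δ ε (w * t)

/-- `F_{mnd}(u)`. -/
def hypF (m n : ℝ) (d : ℕ) (u : ℝ) : ℝ :=
  hyp3F2 (m + n - (d : ℝ) / 2) m n ((m + n) / 2) ((m + n + 1) / 2) (-u)

/-- The function `𝒮_{ℓmnd}(u)`. -/
def SFun (l m n : ℝ) (d : ℕ) (u : ℝ) : ℝ :=
  Real.Gamma (m + n - (d : ℝ) / 2) / ((4 * Real.pi) ^ ((d : ℝ) / 2) * Real.Gamma (m + n)) *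
    (1 + 4 * u) ^ l * hypF m n d u

/-- The `𝒮`-function upper bound `K^𝒮_{ℓmnd} = √(sup_{u ≥ 0} 𝒮_{ℓmnd}(u))`. -/
def upperK (l m n : ℝ) (d : ℕ) : ℝ := Real.sqrt (sSup (SFun l m n d '' Ici 0))

/-- The function `Σ_{bcdℓ}(u)`. -/
def SigmaFun (b c : ℝ) (d : ℕ) (l u : ℝ) : ℝ :=
  (1 + 4 * u) ^ l *
    hyp3F2 ((b + c) * l - (d : ℝ) / 2) (b * l) (c * l) ((b + c) * l / 2) (((b + c) * l + 1) / 2)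
      (-u)

/-- Condition `𝔖_{bcd}`: for large `ℓ` the supremum is finite, and it is `1 + O(1/ℓ)`. -/
def ConditionS (b c : ℝ) (d : ℕ) : Prop :=
  (∀ᶠ l : ℝ in atTop, BddAbove (SigmaFun b c d l '' Ici 0)) ∧
    (fun l : ℝ => sSup (SigmaFun b c d l '' Ici 0) - 1) =O[atTop] (fun l : ℝ => 1 / l)

/-- The Gaussian `f_{σd}(x) = e^(-σ|x|²/2)`. -/
def gaussianFun (d : ℕ) (σ : ℝ) (x : Rd d) : ℂ := ((Real.exp (-σ * ‖x‖ ^ 2 / 2) : ℝ) : ℂ)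

/-- The lower bound given by the pair of trial functions `f_{σd}`, `f_{τd}`, whose product is
`f_{σ+τ,d}`. -/
def lowerK (l m n : ℝ) (d : ℕ) (σ τ : ℝ) : ℝ :=
  sobolevNorm l (gaussianFun d (σ + τ)) /
    (sobolevNorm m (gaussianFun d σ) * sobolevNorm n (gaussianFun d τ))

/-- The set `Δ_{bc}`. -/
def DeltaSet (b c : ℝ) : Set (ℝ × ℝ) :=
  {p | p.1 ∈ Ioo 0 (1 / b) ∧ p.2 ∈ Ioo 0 (1 / c) ∧ p.1 + p.2 < 1}

/-- The function `D_{bc}(ξ, η)`. -/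
def DFun (b c : ℝ) (p : ℝ × ℝ) : ℝ :=
  (1 - p.1 - p.2) * (p.1 + p.2) / (p.1 * p.2 * (1 - b * p.1) * (1 - c * p.2))

/-- `f(ℓ) = (1 + O(1/ℓ)) / g(ℓ)` as `ℓ → +∞`. -/
def EqOneAddBigODiv (f g : ℝ → ℝ) : Prop :=
  ∃ r : ℝ → ℝ, r =O[atTop] (fun l : ℝ => 1 / l) ∧ ∀ᶠ l : ℝ in atTop, f l = (1 + r l) / g l

end

/-! The sharp constant is squeezed between two explicit quantities with the same leading term.

Upper bound. The transform of `fg` is `(2π)^(-d/2)` times the convolution of the transforms.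
Cauchy–Schwarz with the Sobolev weights shows that `K` is admissible once `K²` dominates `(2π)^(-d)
(1+|k|²)^ℓ ∫ (1+|p|²)^(-m) (1+|k-p|²)^(-n) dp` for every `k` (`mem_multConstants_of_bound`).
Feynman's parametrisation turns this convolution into a Beta mean of `(1+wu)^(-(m+n-d/2))`, where `w
= 4s(1-s)` and `u = |k|²/4`. The integral defining the `₃F₂` gives the same mean, so the quantity is
exactly `𝒮(u)` (`sobolevWeight_convolution_eq_SFun`).

Its supremum for `m = n = 2ℓ`. The factor `Γ(4ℓ-d/2)/Γ(4ℓ)`, of order `(4ℓ)^(-d/2)`, together with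
`(4π)^(-d/2)` produces `(16πℓ)^(-d/2)`, so it remains to see that `sup Σ = 1 + O(1/ℓ)`. Now `Σ(0) =
1`, and the mean of `w^(-ℓ)` is at most 2 for `ℓ ≥ 1`. For `u ≤ 1/3` an interpolation between the
powers `w^0` and `w^(-ℓ)` yields `Σ(u) ≤ exp((4+d/2)u - ℓu²)`, which is at most `exp(O(1/ℓ))`
(`SigmaFun_two_two_le_of_small`). For `u ≥ 1/3`, `Σ` is exponentially small in `ℓ`
(`SigmaFun_two_two_le_of_large`).

Lower bound. With `σ = 1/(2λ)` the Gaussian has squared `H^λ` norm `σ^(-d) ∫ (1+|k|²)^λ e^(-2λ|k|²)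
dk`. The mass sits at `|k|² ~ 1/λ`, where `(1+|k|²)^λ` is close to `e^(λ|k|²)`, so the norm squared
is `(4πλ)^(d/2) (1+O(1/λ))`. Taking `λ = 2ℓ` for both factors gives `λ = ℓ` for the product, and the
quotient is `(4πℓ)^(d/4) / (8πℓ)^(d/2) = (16πℓ)^(-d/4)` to leading order. -/

/-! ### Fourier transform of products, and agreement of the `L¹` and `L²` transforms. -/

section FourierL2

open SchwartzMap

variable {E : Type*} [NormedAddCommGroup E] [InnerProductSpace ℝ E] [FiniteDimensional ℝ E]
  [MeasurableSpace E] [BorelSpace E]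

theorem SchwartzMap.fourier_fourier_apply (f : 𝓢(E, ℂ)) (x : E) : 𝓕 (𝓕 f) x = f (-x) := by
  have h : 𝓕⁻ (𝓕 f) (-x) = f (-x) := by rw [FourierTransform.fourierInv_fourier_eq]
  rw [← h, SchwartzMap.fourierInv_coe, SchwartzMap.fourier_coe, Real.fourierInv_eq_fourier_neg,
    neg_neg]

theorem SchwartzMap.fourier_mul_eq_integral (f g : 𝓢(E, ℂ)) (ξ : E) :
    𝓕 (fun x => f x * g x) ξ = ∫ η, 𝓕 f η * 𝓕 g (ξ - η) := by
  have h := convolution_apply (ContinuousLinearMap.mul ℂ ℂ) (𝓕 f) (𝓕 g) ξ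
  rw [MeasureTheory.convolution] at h
  simp only [ContinuousLinearMap.mul_apply'] at h
  rw [← h]
  -- By definition the Schwartz convolution is the inverse transform of a product of transforms; the
  -- double transforms are reflections, which the sign in `𝓕⁻` undoes.
  have h2 : convolution (ContinuousLinearMap.mul ℂ ℂ) (𝓕 f) (𝓕 g)
      = 𝓕⁻ (pairing (ContinuousLinearMap.mul ℂ ℂ) (𝓕 (𝓕 f)) (𝓕 (𝓕 g))) := rfl
  rw [h2, SchwartzMap.fourierInv_coe, Real.fourierInv_eq_fourier_comp_neg]
  refine congrFun (congrArg _ (funext fun x => ?_)) ξ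
  simp [SchwartzMap.fourier_fourier_apply]

theorem MeasureTheory.measurePreserving_const_sub (ξ : E) :
    MeasurePreserving (fun η : E => ξ - η) volume volume :=
  Measure.measurePreserving_sub_left volume ξ

theorem MeasureTheory.Lp.continuous_integral_mul_comp_const_sub (ξ : E) :
    Continuous fun p : Lp ℂ 2 (volume : Measure E) × Lp ℂ 2 (volume : Measure E) =>
      ∫ η, p.1 η * p.2 (ξ - η) := by
  have h1 : Continuous fun f : Lp ℂ 2 (volume : Measure E) =>
      Lp.compMeasurePreserving _ (measurePreserving_const_sub ξ) f :=
    (Lp.isometry_compMeasurePreserving (measurePreserving_const_sub ξ)).continuous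
  have h2 := ((ContinuousLinearMap.mul ℂ ℂ).lpPairing (volume : Measure E) 2 2).continuous₂
  refine (h2.comp (continuous_fst.prodMk (h1.comp continuous_snd))).congr fun p => ?_
  simp only [Function.comp, Function.uncurry, ContinuousLinearMap.lpPairing_eq_integral]
  refine integral_congr_ae ?_
  filter_upwards [Lp.coeFn_compMeasurePreserving p.2 (measurePreserving_const_sub ξ)] with x hx
  rw [hx]; rfl

theorem MeasureTheory.Lp.continuous_fourier_mul (ξ : E) :
    Continuous fun p : Lp ℂ 2 (volume : Measure E) × Lp ℂ 2 (volume : Measure E) =>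
      𝓕 (fun x => p.1 x * p.2 x) ξ := by
  have h1 := ((ContinuousLinearMap.mul ℂ ℂ).holderL (volume : Measure E) 2 2 1).continuous₂
  have h2 := (BoundedContinuousFunction.evalCLM ℂ ξ).continuous.comp
    (Real.Lp.fourierTransformCLM E ℂ).continuous
  refine (h2.comp h1).congr fun p => ?_
  exact Real.fourier_congr_ae ((ContinuousLinearMap.mul ℂ ℂ).coeFn_holder (r := 1) p.1 p.2) ξ

/-- The Fourier transform of the (integrable) product of two square integrable functions is the
convolution of their Fourier transforms. -/
theorem MeasureTheory.Lp.fourier_mul_eq_integral (f g : Lp ℂ 2 (volume : Measure E)) (ξ : E) :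
    𝓕 (fun x => f x * g x) ξ =
      ∫ η, (𝓕 f : Lp ℂ 2 (volume : Measure E)) η * (𝓕 g : Lp ℂ 2 (volume : Measure E)) (ξ - η) := by
  -- Both sides are continuous in `(f, g)` on `L² × L²`, so the Schwartz case suffices.
  have hd : DenseRange (SchwartzMap.toLpCLM ℂ (E := E) ℂ 2 volume) :=
    SchwartzMap.denseRange_toLpCLM (p := 2) ENNReal.ofNat_ne_top
  have h0 : Continuous fun f : Lp ℂ 2 (volume : Measure E) => (𝓕 f : Lp ℂ 2 (volume : Measure E)) :=
    (Lp.fourierTransformₗᵢ E ℂ).continuous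
  refine hd.induction_on₂ (p := fun f g : Lp ℂ 2 (volume : Measure E) =>
    𝓕 (fun x => f x * g x) ξ = ∫ η, (𝓕 f : Lp ℂ 2 (volume : Measure E)) η *
      (𝓕 g : Lp ℂ 2 (volume : Measure E)) (ξ - η)) ?_ ?_ f g
  · exact isClosed_eq (Lp.continuous_fourier_mul ξ)
      ((Lp.continuous_integral_mul_comp_const_sub ξ).comp
        ((h0.comp continuous_fst).prodMk (h0.comp continuous_snd)))
  · intro a b
    simp only [toLpCLM_apply, toLp_fourier_eq]
    have e4 := (measurePreserving_const_sub ξ).quasiMeasurePreserving.ae_eq_comp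
      ((𝓕 b).coeFn_toLp 2 volume)
    have e5 := Real.fourier_congr_ae ((a.coeFn_toLp 2 volume).mul (b.coeFn_toLp 2 volume)) ξ
    refine (e5.trans (SchwartzMap.fourier_mul_eq_integral a b ξ)).trans (integral_congr_ae ?_)
    filter_upwards [(𝓕 a).coeFn_toLp 2 volume, e4] with x h3 h4
    rw [h3]; simp only [Function.comp] at h4; rw [h4]

/-- An integrable function whose Fourier transform is square integrable is square integrable, and
its Fourier transforms as an element of `L¹` and of `L²` agree. -/
theorem MeasureTheory.Integrable.exists_memLp_two_of_fourier {h : E → ℂ} (h1 : Integrable h)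
    (h2 : MemLp (𝓕 h) 2 volume) :
    ∃ hh : MemLp h 2 volume, (𝓕 (hh.toLp h) : Lp ℂ 2 (volume : Measure E)) =ᵐ[volume] 𝓕 h := by
  set G : Lp ℂ 2 (volume : Measure E) := 𝓕⁻ (h2.toLp (𝓕 h)) with hG
  have hFG : 𝓕 G = h2.toLp (𝓕 h) := FourierTransform.fourier_fourierInv_eq _
  -- Test against smooth compactly supported `φ = 𝓕 χ` and move the transform onto `χ`: for `h` by
  -- Fubini, for `G` as a tempered distribution.
  have hae : h =ᵐ[volume] G := by
    refine ae_eq_of_integral_contDiff_smul_eq h1.locallyIntegrable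
      ((Lp.memLp G).locallyIntegrable (by norm_num)) ?_
    intro φ hφ hφc
    have hg₁ : HasCompactSupport (Complex.ofRealCLM ∘ φ) := hφc.comp_left rfl
    have hg₂ : ContDiff ℝ (⊤ : ℕ∞) (Complex.ofRealCLM ∘ φ) := by fun_prop
    set ψ : 𝓢(E, ℂ) := hg₁.toSchwartzMap hg₂
    have hψ : ∀ x, ψ x = (φ x : ℂ) := fun x => rfl
    set χ : 𝓢(E, ℂ) := 𝓕⁻ ψ
    have hχ : 𝓕 χ = ψ := FourierTransform.fourier_fourierInv_eq _
    have e1 : ∫ x, χ x • 𝓕 h x = ∫ x, ψ x • h x := by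
      have := VectorFourier.integral_fourierIntegral_smul_eq_flip (μ := volume) (ν := volume)
        (L := innerₗ E) Real.continuous_fourierChar continuous_inner χ.integrable h1
      rw [← hχ]
      simpa using! this.symm
    have e2 := congrArg (fun T => T χ) (Lp.fourier_toTemperedDistribution_eq G)
    simp only [TemperedDistribution.fourier_apply, Lp.toTemperedDistribution_apply, hχ, hFG] at e2
    have e3 : ∫ x, χ x • (h2.toLp (𝓕 h)) x = ∫ x, χ x • 𝓕 h x := by
      refine integral_congr_ae ?_
      filter_upwards [h2.coeFn_toLp] with x hx
      rw [hx]
    rw [e3, e1] at e2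
    simp only [hψ, Complex.real_smul, smul_eq_mul] at e2 ⊢
    exact e2.symm
  have hh : MemLp h 2 volume := (memLp_congr_ae hae).2 (Lp.memLp G)
  refine ⟨hh, ?_⟩
  have : hh.toLp h = G := by
    apply Lp.ext
    exact hh.coeFn_toLp.trans hae
  rw [this, hFG]
  exact h2.coeFn_toLp

end FourierL2

/-! ### Sobolev norms and the Cauchy–Schwarz bound for products. -/

section SobolevProduct

variable {d : ℕ}

theorem MeasureTheory.quasiMeasurePreserving_const_smul {a : ℝ} (ha : a ≠ 0) :
    Measure.QuasiMeasurePreserving (fun k : Rd d => a • k) volume volume := by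
  refine ⟨by fun_prop, ?_⟩
  rw [Measure.map_addHaar_smul _ ha]
  exact Measure.smul_absolutelyContinuous

theorem MeasureTheory.ae_eq_comp_const_smul {β : Type*} {F G : Rd d → β} (h : F =ᵐ[volume] G) {a : ℝ}
    (ha : a ≠ 0) : (fun k => F (a • k)) =ᵐ[volume] fun k => G (a • k) :=
  (quasiMeasurePreserving_const_smul ha).ae_eq_comp h

theorem memLp_comp_const_smul_iff {F : Rd d → ℂ} {a : ℝ} (ha : a ≠ 0) :
    MemLp (fun k => F (a • k)) 2 volume ↔ MemLp F 2 volume := by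
  have key : ∀ (F : Rd d → ℂ) {a : ℝ} (ha : a ≠ 0), MemLp F 2 volume →
      MemLp (fun k => F (a • k)) 2 volume := by
    intro F a ha hF
    have h1 : MemLp F 2 (Measure.map (fun k : Rd d => a • k) volume) := by
      rw [Measure.map_addHaar_smul _ ha]
      exact hF.smul_measure ENNReal.ofReal_ne_top
    exact h1.comp_of_map (by fun_prop)
  refine ⟨fun h => ?_, key F ha⟩
  have := key _ (inv_ne_zero ha) h
  simpa [smul_smul, mul_inv_cancel₀ ha] using this

theorem fourierL2_of_memLp {f : Rd d → ℂ} (hf : MemLp f 2 volume) (k : Rd d) :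
    fourierL2 f k = (((2 * Real.pi) ^ (-(d : ℝ) / 2) : ℝ) : ℂ) *
      (𝓕 (hf.toLp f) : Lp ℂ 2 (volume : Measure (Rd d))) ((2 * Real.pi)⁻¹ • k) := by
  rw [fourierL2, dif_pos hf]

theorem two_pi_inv_ne_zero : (2 * Real.pi)⁻¹ ≠ 0 := by positivity

theorem aestronglyMeasurable_fourierL2 (f : Rd d → ℂ) :
    AEStronglyMeasurable (fourierL2 f) volume := by
  by_cases hf : MemLp f 2 volume
  · have : fourierL2 f = fun k => (((2 * Real.pi) ^ (-(d : ℝ) / 2) : ℝ) : ℂ) *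
      (𝓕 (hf.toLp f) : Lp ℂ 2 (volume : Measure (Rd d))) ((2 * Real.pi)⁻¹ • k) :=
      funext (fourierL2_of_memLp hf)
    rw [this]
    exact AEStronglyMeasurable.const_mul ((Lp.aestronglyMeasurable _).comp_quasiMeasurePreserving
      (quasiMeasurePreserving_const_smul two_pi_inv_ne_zero)) _
  · have : fourierL2 f = fun _ => 0 := funext fun k => by rw [fourierL2, dif_neg hf]
    rw [this]
    exact aestronglyMeasurable_const

theorem continuous_sobolevWeight (s : ℝ) : Continuous fun k : Rd d => (1 + ‖k‖ ^ 2) ^ s :=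
  Continuous.rpow_const (by fun_prop) fun k => Or.inl (by positivity)

theorem sqrt_rpow_eq {x : ℝ} (hx : 0 ≤ x) (s : ℝ) : (Real.sqrt x ^ s) ^ 2 = x ^ s := by
  rw [← Real.rpow_natCast, ← Real.rpow_mul (Real.sqrt_nonneg _), mul_comm s, Real.rpow_mul
    (Real.sqrt_nonneg _)]
  simp [Real.sq_sqrt hx]

theorem aestronglyMeasurable_weightedFourier (s : ℝ) (f : Rd d → ℂ) :
    AEStronglyMeasurable (weightedFourier s f) volume := by
  refine AEStronglyMeasurable.mul ?_ (aestronglyMeasurable_fourierL2 f)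
  refine Continuous.aestronglyMeasurable (Complex.continuous_ofReal.comp ?_)
  exact Continuous.rpow_const (by fun_prop) fun k => Or.inl (by positivity)

theorem eLpNorm_two_sq {α : Type*} [MeasurableSpace α] {μ : Measure α} (F : α → ℂ) :
    eLpNorm F 2 μ ^ 2 = ∫⁻ x, ‖F x‖ₑ ^ 2 ∂μ := by
  have := eLpNorm_nnreal_pow_eq_lintegral (μ := μ) (f := F) (p := 2) two_ne_zero
  simpa using this

theorem eLpNorm_weightedFourier_sq (s : ℝ) (f : Rd d → ℂ) :
    eLpNorm (weightedFourier s f) 2 volume ^ 2 =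
      ∫⁻ k, ENNReal.ofReal ((1 + ‖k‖ ^ 2) ^ s) * ‖fourierL2 f k‖ₑ ^ 2 := by
  rw [eLpNorm_two_sq]
  refine lintegral_congr fun k => ?_
  rw [weightedFourier, enorm_mul, mul_pow]
  congr 1
  rw [← ofReal_norm, Complex.norm_real, Real.norm_of_nonneg (by positivity),
    ← ENNReal.ofReal_pow (by positivity), sqrt_rpow_eq (by positivity)]

theorem two_pi_rpow_neg_half_sq (d : ℕ) :
    ((2 * Real.pi) ^ (-(d : ℝ) / 2)) ^ 2 = (2 * Real.pi) ^ (-(d : ℝ)) := by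
  rw [← Real.rpow_natCast, ← Real.rpow_mul (by positivity)]
  norm_num

/-- With the unitary normalisation, `𝓕(fg) = (2π)^(-d/2) 𝓕f * 𝓕g`. -/
theorem fourier_mul_eq_integral_fourierL2 {f g : Rd d → ℂ} (hf : MemLp f 2 volume)
    (hg : MemLp g 2 volume) (k : Rd d) :
    𝓕 (fun x => f x * g x) ((2 * Real.pi)⁻¹ • k) = ∫ p, fourierL2 f p * fourierL2 g (k - p) := by
  have e1 := Real.fourier_congr_ae (hf.coeFn_toLp.mul hg.coeFn_toLp) ((2 * Real.pi)⁻¹ • k)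
  refine e1.symm.trans ((Lp.fourier_mul_eq_integral (hf.toLp f) (hg.toLp g) _).trans ?_)
  simp only [fourierL2_of_memLp hf, fourierL2_of_memLp hg, smul_sub]
  have h2 := Measure.integral_comp_smul (volume : Measure (Rd d))
    (fun η => (𝓕 (hf.toLp f) : Lp ℂ 2 (volume : Measure (Rd d))) η *
      (𝓕 (hg.toLp g) : Lp ℂ 2 (volume : Measure (Rd d))) ((2 * Real.pi)⁻¹ • k - η)) (2 * Real.pi)⁻¹
  have h3 : (((2 * Real.pi) ^ (-(d : ℝ) / 2) : ℝ) : ℂ) ^ 2 * (|((2 * Real.pi)⁻¹ ^ d)⁻¹| : ℝ) = 1 := by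
    rw [← Complex.ofReal_pow, two_pi_rpow_neg_half_sq, ← Complex.ofReal_mul, abs_of_nonneg
      (by positivity), inv_pow, inv_inv, Real.rpow_neg (by positivity), Real.rpow_natCast,
      inv_mul_cancel₀ (by positivity), Complex.ofReal_one]
  simp only [finrank_euclideanSpace, Fintype.card_fin, Complex.real_smul] at h2
  rw [← one_mul (∫ η, _ * _), ← h3, mul_assoc, ← h2, ← integral_const_mul]
  refine integral_congr_ae (Eventually.of_forall fun p => ?_)
  simp only
  ring

theorem ENNReal.sq_lintegral_mul_le {α : Type*} [MeasurableSpace α] {μ : Measure α}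
    {u v : α → ℝ≥0∞} (hu : AEMeasurable u μ) (hv : AEMeasurable v μ) :
    (∫⁻ x, u x * v x ∂μ) ^ 2 ≤ (∫⁻ x, u x ^ 2 ∂μ) * ∫⁻ x, v x ^ 2 ∂μ := by
  have h := ENNReal.lintegral_mul_le_Lp_mul_Lq μ Real.HolderConjugate.two_two hu hv
  have h' := pow_le_pow_left₀ (zero_le) h 2
  refine h'.trans_eq ?_
  rw [mul_pow, ← ENNReal.rpow_natCast, ← ENNReal.rpow_mul, ← ENNReal.rpow_natCast,
    ← ENNReal.rpow_mul]
  norm_num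

/-- Cauchy–Schwarz after inserting `1 = W^(-1/2) · W^(1/2)` with `W` the product of the two Sobolev
weights. -/
theorem enorm_integral_mul_sq_le {m n : ℝ} {F G : Rd d → ℂ} (hF : AEStronglyMeasurable F volume)
    (hG : AEStronglyMeasurable G volume) (k : Rd d) :
    ‖∫ p, F p * G (k - p)‖ₑ ^ 2 ≤
      (∫⁻ p : Rd d, ENNReal.ofReal ((1 + ‖p‖ ^ 2) ^ (-m) * (1 + ‖k - p‖ ^ 2) ^ (-n))) *
      ∫⁻ p, (ENNReal.ofReal ((1 + ‖p‖ ^ 2) ^ m) * ‖F p‖ₑ ^ 2) *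
        (ENNReal.ofReal ((1 + ‖k - p‖ ^ 2) ^ n) * ‖G (k - p)‖ₑ ^ 2) := by
  have hG' : AEStronglyMeasurable (fun p => G (k - p)) volume :=
    hG.comp_quasiMeasurePreserving (measurePreserving_const_sub k).quasiMeasurePreserving
  have hc : ∀ s : ℝ, Continuous fun p : Rd d => (1 + ‖k - p‖ ^ 2) ^ s := fun s =>
    (continuous_sobolevWeight s).comp (continuous_const.sub continuous_id)
  have hcs : ∀ s t : ℝ, Continuous fun p : Rd d => Real.sqrt ((1 + ‖p‖ ^ 2) ^ s *
      (1 + ‖k - p‖ ^ 2) ^ t) := fun s t => ((continuous_sobolevWeight s).mul (hc t)).sqrt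
  have h := ENNReal.sq_lintegral_mul_le (μ := (volume : Measure (Rd d)))
    (u := fun p => ENNReal.ofReal (Real.sqrt ((1 + ‖p‖ ^ 2) ^ (-m) * (1 + ‖k - p‖ ^ 2) ^ (-n))))
    (v := fun p => ENNReal.ofReal (Real.sqrt ((1 + ‖p‖ ^ 2) ^ m * (1 + ‖k - p‖ ^ 2) ^ n)) *
      (‖F p‖ₑ * ‖G (k - p)‖ₑ))
    (hcs _ _).measurable.ennreal_ofReal.aemeasurable
    ((hcs _ _).measurable.ennreal_ofReal.aemeasurable.mul (hF.enorm.mul hG'.enorm))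
  refine le_trans (pow_le_pow_left₀ (zero_le) ((enorm_integral_le_lintegral_enorm _).trans_eq
    (lintegral_congr fun p => ?_)) 2) (h.trans_eq ?_)
  · rw [enorm_mul, ← mul_assoc, ← ENNReal.ofReal_mul (by positivity), ← Real.sqrt_mul (by positivity)]
    rw [Real.rpow_neg (by positivity), Real.rpow_neg (by positivity)]
    have h1 : 0 < (1 + ‖p‖ ^ 2) ^ m := by positivity
    have h2 : 0 < (1 + ‖k - p‖ ^ 2) ^ n := by positivity
    rw [show ((1 + ‖p‖ ^ 2) ^ m)⁻¹ * ((1 + ‖k - p‖ ^ 2) ^ n)⁻¹ *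
      ((1 + ‖p‖ ^ 2) ^ m * (1 + ‖k - p‖ ^ 2) ^ n) = 1 by field_simp]
    simp
  · congr 1
    · refine lintegral_congr fun p => ?_
      rw [← ENNReal.ofReal_pow (by positivity), Real.sq_sqrt (by positivity)]
    · refine lintegral_congr fun p => ?_
      rw [mul_pow, ← ENNReal.ofReal_pow (by positivity), Real.sq_sqrt (by positivity),
        ENNReal.ofReal_mul (by positivity)]
      ring

theorem lintegral_lintegral_mul_const_sub {A B : Rd d → ℝ≥0∞} (hA : AEMeasurable A volume)
    (hB : AEMeasurable B volume) :
    ∫⁻ k, ∫⁻ p, A p * B (k - p) = (∫⁻ p, A p) * ∫⁻ p, B p := by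
  rw [lintegral_lintegral_swap]
  · rw [← lintegral_mul_const'' _ hA]
    refine lintegral_congr fun p => ?_
    have h1 : AEMeasurable (fun k => B (k - p)) volume :=
      hB.comp_quasiMeasurePreserving (measurePreserving_sub_right volume p).quasiMeasurePreserving
    rw [lintegral_const_mul'' _ h1, lintegral_sub_right_eq_self]
  · exact (hA.comp_quasiMeasurePreserving Measure.quasiMeasurePreserving_snd).mul
      (hB.comp_quasiMeasurePreserving (quasiMeasurePreserving_sub_of_right_invariant volume volume))

/-- The Schur-type criterion: a uniform bound on the convolution of the inverse weights gives a
constant in the multiplication inequality. -/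
theorem mem_multConstants_of_bound {l m n K : ℝ} (hl : 0 ≤ l) (hK : 0 ≤ K)
    (hb : ∀ k : Rd d, ENNReal.ofReal ((2 * Real.pi) ^ (-(d : ℝ)) * (1 + ‖k‖ ^ 2) ^ l) *
      (∫⁻ p : Rd d, ENNReal.ofReal ((1 + ‖p‖ ^ 2) ^ (-m) * (1 + ‖k - p‖ ^ 2) ^ (-n))) ≤
        ENNReal.ofReal (K ^ 2)) :
    K ∈ multConstants l m n d := by
  refine ⟨hK, fun f g hf hg => ?_⟩
  have h1 : Integrable (fun x => f x * g x) := hf.1.integrable_mul hg.1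
  set c : ℝ := (2 * Real.pi) ^ (-(d : ℝ) / 2) with hc
  have hc0 : 0 < c := by positivity
  -- Membership `fg ∈ L²` is still open here, so the transform is taken in the `L¹` sense; `W` is
  -- shown to be square integrable first and identified with `fourierL2` afterwards.
  set W : Rd d → ℂ := fun k => (c : ℂ) * 𝓕 (fun x => f x * g x) ((2 * Real.pi)⁻¹ • k) with hW
  have hFm := aestronglyMeasurable_fourierL2 f
  have hGm := aestronglyMeasurable_fourierL2 g
  have hWb : ∀ k, ENNReal.ofReal ((1 + ‖k‖ ^ 2) ^ l) * ‖W k‖ₑ ^ 2 ≤ ENNReal.ofReal (K ^ 2) *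
      ∫⁻ p, (ENNReal.ofReal ((1 + ‖p‖ ^ 2) ^ m) * ‖fourierL2 f p‖ₑ ^ 2) *
        (ENNReal.ofReal ((1 + ‖k - p‖ ^ 2) ^ n) * ‖fourierL2 g (k - p)‖ₑ ^ 2) := by
    intro k
    have h2 := enorm_integral_mul_sq_le (m := m) (n := n) hFm hGm k
    have h3 : ‖W k‖ₑ ^ 2 = ENNReal.ofReal ((2 * Real.pi) ^ (-(d : ℝ))) *
        ‖∫ p, fourierL2 f p * fourierL2 g (k - p)‖ₑ ^ 2 := by
      rw [hW]
      simp only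
      rw [fourier_mul_eq_integral_fourierL2 hf.1 hg.1, enorm_mul, mul_pow, ← two_pi_rpow_neg_half_sq,
        ENNReal.ofReal_pow hc0.le, ← ofReal_norm (c : ℂ), Complex.norm_real,
        Real.norm_of_nonneg hc0.le]
    calc _ = ENNReal.ofReal ((2 * Real.pi) ^ (-(d : ℝ)) * (1 + ‖k‖ ^ 2) ^ l) *
          ‖∫ p, fourierL2 f p * fourierL2 g (k - p)‖ₑ ^ 2 := by
          rw [h3, ENNReal.ofReal_mul (by positivity)]; ring
      _ ≤ _ := (mul_le_mul_right h2 _)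
      _ ≤ _ := by
          rw [← mul_assoc]
          exact mul_le_mul_left (hb k) _
  have hWc : Continuous W := by
    have : Continuous (𝓕 (fun x => f x * g x)) :=
      VectorFourier.fourierIntegral_continuous Real.continuous_fourierChar
        (innerSL ℝ).continuous₂ h1
    exact continuous_const.mul (this.comp (continuous_const_smul _))
  have hAf : AEMeasurable (fun p => ENNReal.ofReal ((1 + ‖p‖ ^ 2) ^ m) * ‖fourierL2 f p‖ₑ ^ 2) volume :=
    (continuous_sobolevWeight m).measurable.ennreal_ofReal.aemeasurable.mul (hFm.enorm.pow_const 2)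
  have hAg : AEMeasurable (fun p => ENNReal.ofReal ((1 + ‖p‖ ^ 2) ^ n) * ‖fourierL2 g p‖ₑ ^ 2) volume :=
    (continuous_sobolevWeight n).measurable.ennreal_ofReal.aemeasurable.mul (hGm.enorm.pow_const 2)
  have hWI : ∫⁻ k, ENNReal.ofReal ((1 + ‖k‖ ^ 2) ^ l) * ‖W k‖ₑ ^ 2 ≤ ENNReal.ofReal (K ^ 2) *
      (eLpNorm (weightedFourier m f) 2 volume ^ 2 * eLpNorm (weightedFourier n g) 2 volume ^ 2) := by
    rw [eLpNorm_weightedFourier_sq, eLpNorm_weightedFourier_sq,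
      ← lintegral_lintegral_mul_const_sub hAf hAg, ← lintegral_const_mul' _ _ ENNReal.ofReal_ne_top]
    exact lintegral_mono hWb
  have hfin : ENNReal.ofReal (K ^ 2) * (eLpNorm (weightedFourier m f) 2 volume ^ 2 *
      eLpNorm (weightedFourier n g) 2 volume ^ 2) < ⊤ :=
    ENNReal.mul_lt_top ENNReal.ofReal_lt_top (ENNReal.mul_lt_top
      (ENNReal.pow_lt_top hf.2.2) (ENNReal.pow_lt_top hg.2.2))
  have hWL : MemLp W 2 volume := by
    refine ⟨hWc.aestronglyMeasurable, ?_⟩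
    have : eLpNorm W 2 volume ^ 2 < ⊤ := by
      rw [eLpNorm_two_sq]
      refine lt_of_le_of_lt (lintegral_mono fun k => ?_) (hWI.trans_lt hfin)
      -- Since `ℓ ≥ 0` the weight is at least 1, so the weighted bound controls the plain `L²` norm.
      refine le_mul_of_one_le_left (zero_le) ?_
      rw [ENNReal.one_le_ofReal]
      exact Real.one_le_rpow (by nlinarith [sq_nonneg ‖k‖]) hl
    exact (ENNReal.pow_lt_top_iff).1 this |>.resolve_right two_ne_zero
  have hH : MemLp (𝓕 (fun x => f x * g x)) 2 volume := by
    rw [← memLp_comp_const_smul_iff two_pi_inv_ne_zero]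
    have := hWL.const_mul (c : ℂ)⁻¹
    refine (memLp_congr_ae (Eventually.of_forall fun k => ?_)).1 this
    simp only [hW]
    rw [← mul_assoc, inv_mul_cancel₀ (by exact_mod_cast hc0.ne'), one_mul]
  obtain ⟨hh, hae⟩ := h1.exists_memLp_two_of_fourier hH
  have hae2 : fourierL2 (fun x => f x * g x) =ᵐ[volume] W := by
    filter_upwards [ae_eq_comp_const_smul hae two_pi_inv_ne_zero] with k hk
    rw [fourierL2_of_memLp hh, hk]
  have hsq : eLpNorm (weightedFourier l fun x => f x * g x) 2 volume ^ 2 ≤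
      (ENNReal.ofReal K * eLpNorm (weightedFourier m f) 2 volume *
        eLpNorm (weightedFourier n g) 2 volume) ^ 2 := by
    rw [eLpNorm_weightedFourier_sq, mul_pow, mul_pow, ← ENNReal.ofReal_pow hK, mul_assoc]
    refine le_trans (lintegral_congr_ae ?_).le hWI
    filter_upwards [hae2] with k hk
    rw [hk]
  have hle := (ENNReal.pow_le_pow_left_iff two_ne_zero).1 hsq
  have hfin2 : ENNReal.ofReal K * eLpNorm (weightedFourier m f) 2 volume *
      eLpNorm (weightedFourier n g) 2 volume < ⊤ :=
    ENNReal.mul_lt_top (ENNReal.mul_lt_top ENNReal.ofReal_lt_top hf.2.2) hg.2.2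
  refine ⟨⟨hh, aestronglyMeasurable_weightedFourier _ _, hle.trans_lt hfin2⟩, ?_⟩
  have := ENNReal.toReal_mono hfin2.ne hle
  simpa [sobolevNorm, ENNReal.toReal_mul, ENNReal.toReal_ofReal hK] using this

end SobolevProduct

/-! ### The hypergeometric function as a Beta mean. -/

section Hypergeometric

open ProbabilityTheory (beta beta_pos)

/-- The density `s^(m-1) (1-s)^(n-1)` on `(0, 1)`. -/
noncomputable def betaWeight (m n s : ℝ) : ℝ := s ^ (m - 1) * (1 - s) ^ (n - 1)

theorem measurable_betaWeight (m n : ℝ) : Measurable (betaWeight m n) := by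
  unfold betaWeight; fun_prop

theorem betaWeight_nonneg (m n : ℝ) {s : ℝ} (hs : s ∈ Ioo (0 : ℝ) 1) : 0 ≤ betaWeight m n s :=
  mul_nonneg (Real.rpow_nonneg hs.1.le _) (Real.rpow_nonneg (sub_nonneg.2 hs.2.le) _)

theorem lintegral_betaWeight {m n : ℝ} (hm : 0 < m) (hn : 0 < n) :
    ∫⁻ s in Ioo (0 : ℝ) 1, ENNReal.ofReal (betaWeight m n s) = ENNReal.ofReal (beta m n) := by
  have h := ProbabilityTheory.lintegral_betaPDF_eq_one hm hn
  rw [ProbabilityTheory.lintegral_betaPDF] at h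
  have hb := beta_pos hm hn
  have h2 : ∀ s : ℝ, ENNReal.ofReal (betaWeight m n s) = ENNReal.ofReal (beta m n) *
      ENNReal.ofReal (1 / beta m n * s ^ (m - 1) * (1 - s) ^ (n - 1)) := by
    intro s
    rw [← ENNReal.ofReal_mul hb.le, betaWeight]
    congr 1
    field_simp
  simp_rw [h2]
  rw [lintegral_const_mul' _ _ ENNReal.ofReal_ne_top, h, mul_one]

theorem integrableOn_betaWeight {m n : ℝ} (hm : 0 < m) (hn : 0 < n) :
    IntegrableOn (betaWeight m n) (Ioo 0 1) := by
  refine ⟨(measurable_betaWeight m n).aestronglyMeasurable, ?_⟩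
  rw [hasFiniteIntegral_iff_ofReal
    ((ae_restrict_iff' measurableSet_Ioo).2 (Eventually.of_forall fun s hs => betaWeight_nonneg m n hs)),
    lintegral_betaWeight hm hn]
  exact ENNReal.ofReal_lt_top

theorem integral_betaWeight {m n : ℝ} (hm : 0 < m) (hn : 0 < n) :
    ∫ s in Ioo (0 : ℝ) 1, betaWeight m n s = beta m n := by
  rw [integral_eq_lintegral_of_nonneg_ae
    ((ae_restrict_iff' measurableSet_Ioo).2 (Eventually.of_forall fun s hs => betaWeight_nonneg m n hs))
    (measurable_betaWeight m n).aestronglyMeasurable, lintegral_betaWeight hm hn,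
    ENNReal.toReal_ofReal (beta_pos hm hn).le]

theorem poch_succ (a : ℝ) (k : ℕ) : poch a (k + 1) = poch a k * (a + k) := by
  rw [poch, ascPochhammer_succ_eval]; rfl

theorem poch_zero (a : ℝ) : poch a 0 = 1 := by simp [poch]

theorem poch_pos {a : ℝ} (ha : 0 < a) (k : ℕ) : 0 < poch a k := by
  induction k with
  | zero => simp [poch_zero]
  | succ k ih => rw [poch_succ]; positivity

theorem poch_mul_Gamma {a : ℝ} (ha : 0 < a) (k : ℕ) :
    poch a k * Real.Gamma a = Real.Gamma (a + k) := by
  induction k with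
  | zero => simp [poch_zero]
  | succ k ih =>
    rw [poch_succ, mul_right_comm, ih, Nat.cast_succ, ← add_assoc, Real.Gamma_add_one (by positivity),
      mul_comm]

theorem poch_two_mul (a : ℝ) (k : ℕ) :
    4 ^ k * (poch (a / 2) k * poch ((a + 1) / 2) k) = poch a (2 * k) := by
  induction k with
  | zero => simp [poch_zero]
  | succ k ih =>
    rw [show 2 * (k + 1) = 2 * k + 1 + 1 by ring, poch_succ a, poch_succ a, ← ih, poch_succ, poch_succ]
    push_cast
    ring

/-- The duplication formula merges the two lower symbols into `(m+n)_{2k}`; what results is the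
`k`-th moment of `4s(1-s)` under the Beta law. -/
theorem poch_ratio_eq_beta {m n : ℝ} (hm : 0 < m) (hn : 0 < n) (k : ℕ) :
    poch m k * poch n k / (poch ((m + n) / 2) k * poch ((m + n + 1) / 2) k) =
      4 ^ k * beta (m + k) (n + k) / beta m n := by
  have h1 := Real.Gamma_pos_of_pos hm
  have h2 := Real.Gamma_pos_of_pos hn
  have h3 := Real.Gamma_pos_of_pos (add_pos hm hn)
  have h4 := poch_pos (add_pos hm hn) (2 * k)
  have h5 : poch ((m + n) / 2) k * poch ((m + n + 1) / 2) k = poch (m + n) (2 * k) / 4 ^ k := by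
    rw [← poch_two_mul]; field_simp
  have h6 := poch_mul_Gamma (add_pos hm hn) (2 * k)
  rw [h5, beta, beta, ← poch_mul_Gamma hm, ← poch_mul_Gamma hn,
    show m + k + (n + k) = m + n + (2 * k : ℕ) by push_cast; ring, ← h6]
  field_simp

theorem betaWeight_mul_pow (m n : ℝ) (k : ℕ) {s : ℝ} (hs : s ∈ Ioo (0 : ℝ) 1) :
    betaWeight m n s * (s * (1 - s)) ^ k = betaWeight (m + k) (n + k) s := by
  have h1 : 0 < 1 - s := sub_pos.2 hs.2
  rw [betaWeight, betaWeight, show m + k - 1 = (m - 1) + k by ring,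
    show n + k - 1 = (n - 1) + k by ring, Real.rpow_add hs.1, Real.rpow_add h1, Real.rpow_natCast,
    Real.rpow_natCast, mul_pow]
  ring

theorem four_mul_mul_one_sub_le (s : ℝ) : 4 * s * (1 - s) ≤ 1 := by nlinarith [sq_nonneg (1 - 2 * s)]

theorem four_mul_mul_one_sub_pos {s : ℝ} (hs : s ∈ Ioo (0 : ℝ) 1) : 0 < 4 * s * (1 - s) :=
  mul_pos (mul_pos four_pos hs.1) (sub_pos.2 hs.2)

/-- The exponential is expanded under the integral; `0 < 4s(1-s) ≤ 1` gives the dominating series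
for `e^|w|`. -/
theorem hyp2F2_eq_integral {m n : ℝ} (hm : 0 < m) (hn : 0 < n) (w : ℝ) :
    hyp2F2 m n ((m + n) / 2) ((m + n + 1) / 2) w =
      (beta m n)⁻¹ * ∫ s in Ioo (0 : ℝ) 1, betaWeight m n s * Real.exp (4 * s * (1 - s) * w) := by
  have hexp : ∀ x : ℝ, HasSum (fun k : ℕ => x ^ k / (k.factorial : ℝ)) (Real.exp x) := by
    intro x
    rw [Real.exp_eq_exp_ℝ]
    exact NormedSpace.expSeries_div_hasSum_exp x
  have hsum : HasSum (fun k : ℕ => ∫ s in Ioo (0 : ℝ) 1, betaWeight m n s *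
        ((4 * s * (1 - s) * w) ^ k / (k.factorial : ℝ)))
      (∫ s in Ioo (0 : ℝ) 1, betaWeight m n s * Real.exp (4 * s * (1 - s) * w)) := by
    refine hasSum_integral_of_dominated_convergence
      (fun k s => betaWeight m n s * (|w| ^ k / (k.factorial : ℝ))) ?_ ?_ ?_ ?_ ?_
    · intro k
      exact ((measurable_betaWeight m n).mul (by fun_prop)).aestronglyMeasurable
    · intro k
      refine (ae_restrict_iff' measurableSet_Ioo).2 (Eventually.of_forall fun s hs => ?_)
      have h1 := (four_mul_mul_one_sub_pos hs).le
      rw [norm_mul, Real.norm_of_nonneg (betaWeight_nonneg m n hs), Real.norm_eq_abs, abs_div, abs_pow,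
        abs_mul, abs_of_nonneg h1, Nat.abs_cast]
      refine mul_le_mul_of_nonneg_left ?_ (betaWeight_nonneg m n hs)
      gcongr
      exact mul_le_of_le_one_left (abs_nonneg _) (four_mul_mul_one_sub_le s)
    · exact Eventually.of_forall fun s => ((hexp |w|).mul_left _).summable
    · have : ∀ s, ∑' k : ℕ, betaWeight m n s * (|w| ^ k / (k.factorial : ℝ)) =
          betaWeight m n s * Real.exp |w| := fun s => ((hexp |w|).mul_left _).tsum_eq
      simp_rw [this]
      exact (integrableOn_betaWeight hm hn).mul_const _
    · exact Eventually.of_forall fun s => (hexp _).mul_left _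
  rw [← hsum.tsum_eq, ← tsum_mul_left, hyp2F2]
  refine tsum_congr fun k => ?_
  have h1 : ∫ s in Ioo (0 : ℝ) 1, betaWeight m n s * ((4 * s * (1 - s) * w) ^ k / (k.factorial : ℝ)) =
      beta (m + k) (n + k) * (4 ^ k * w ^ k / (k.factorial : ℝ)) := by
    rw [← integral_betaWeight (by positivity) (by positivity), ← integral_mul_const]
    refine setIntegral_congr_fun measurableSet_Ioo fun s hs => ?_
    rw [← betaWeight_mul_pow m n k hs, show 4 * s * (1 - s) * w = 4 * w * (s * (1 - s)) by ring,
      mul_pow, mul_pow]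
    ring
  rw [h1, poch_ratio_eq_beta hm hn]
  ring

/-- The Euler type integral `∫₀¹ s^(m-1) (1-s)^(n-1) (1 + 4 s (1-s) u)^(-α) ds`. -/
noncomputable def eulerIntegral (m n α u : ℝ) : ℝ :=
  ∫ s in Ioo (0 : ℝ) 1, betaWeight m n s * (1 + 4 * s * (1 - s) * u) ^ (-α)

theorem one_le_one_add_four_mul {s u : ℝ} (hs : s ∈ Ioo (0 : ℝ) 1) (hu : 0 ≤ u) :
    1 ≤ 1 + 4 * s * (1 - s) * u :=
  le_add_of_nonneg_right (mul_nonneg (four_mul_mul_one_sub_pos hs).le hu)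

/-- Fubini puts the `t`-integral inside, where it is a Gamma integral of rate `1 + 4s(1-s)u`. -/
theorem hyp3F2_eq_eulerIntegral {m n α u : ℝ} (hm : 0 < m) (hn : 0 < n) (hα : 0 < α) (hu : 0 ≤ u) :
    hyp3F2 α m n ((m + n) / 2) ((m + n + 1) / 2) (-u) = (beta m n)⁻¹ * eulerIntegral m n α u := by
  have hG := Real.Gamma_pos_of_pos hα
  have hI1 : IntegrableOn (fun t => Real.exp (-t) * t ^ (α - 1)) (Ioi 0) :=
    Real.GammaIntegral_convergent hα
  rw [hyp3F2]
  simp_rw [hyp2F2_eq_integral hm hn]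
  have hint : Integrable (Function.uncurry fun t s : ℝ => (Real.exp (-t) * t ^ (α - 1)) *
      (betaWeight m n s * Real.exp (4 * s * (1 - s) * (-u * t))))
      ((volume.restrict (Ioi 0)).prod (volume.restrict (Ioo 0 1))) := by
    refine (hI1.mul_prod (integrableOn_betaWeight hm hn)).mono' ?_ ?_
    · refine Measurable.aestronglyMeasurable ?_
      have := measurable_betaWeight m n
      unfold Function.uncurry
      fun_prop
    · rw [Measure.prod_restrict]
      refine (ae_restrict_iff' (measurableSet_Ioi.prod measurableSet_Ioo)).2
        (Eventually.of_forall fun p hp => ?_)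
      have h1 : 0 ≤ Real.exp (-p.1) * p.1 ^ (α - 1) :=
        mul_nonneg (Real.exp_pos _).le (Real.rpow_nonneg (le_of_lt hp.1) _)
      have h2 := betaWeight_nonneg m n hp.2
      have h3 := four_mul_mul_one_sub_pos hp.2
      simp only [Function.uncurry]
      rw [Real.norm_of_nonneg (by positivity)]
      refine mul_le_mul_of_nonneg_left (mul_le_of_le_one_right h2 (Real.exp_le_one_iff.2 ?_)) h1
      have h4 : 0 ≤ u * p.1 := mul_nonneg hu (le_of_lt hp.1)
      nlinarith
  have hswap := integral_integral_swap hint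
  have e1 : ∫ t in Ioi (0 : ℝ), Real.exp (-t) * t ^ (α - 1) * ((beta m n)⁻¹ *
      ∫ s in Ioo (0 : ℝ) 1, betaWeight m n s * Real.exp (4 * s * (1 - s) * (-u * t))) =
      (beta m n)⁻¹ * ∫ t in Ioi (0 : ℝ), ∫ s in Ioo (0 : ℝ) 1, (Real.exp (-t) * t ^ (α - 1)) *
      (betaWeight m n s * Real.exp (4 * s * (1 - s) * (-u * t))) := by
    rw [← integral_const_mul]
    refine integral_congr_ae (Eventually.of_forall fun t => ?_)
    simp only
    rw [integral_const_mul]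
    ring
  rw [e1, hswap, mul_left_comm, ← integral_const_mul, eulerIntegral]
  congr 1
  refine setIntegral_congr_fun measurableSet_Ioo fun s hs => ?_
  have hr : 0 < 1 + 4 * s * (1 - s) * u := zero_lt_one.trans_le (one_le_one_add_four_mul hs hu)
  have h := Real.integral_rpow_mul_exp_neg_mul_Ioi hα hr
  have e2 : ∫ t in Ioi (0 : ℝ), (Real.exp (-t) * t ^ (α - 1)) *
      (betaWeight m n s * Real.exp (4 * s * (1 - s) * (-u * t))) =
      betaWeight m n s * ∫ t in Ioi (0 : ℝ), t ^ (α - 1) * Real.exp (-((1 + 4 * s * (1 - s) * u) * t)) := by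
    rw [← integral_const_mul]
    refine integral_congr_ae (Eventually.of_forall fun t => ?_)
    simp only
    rw [show -((1 + 4 * s * (1 - s) * u) * t) = -t + 4 * s * (1 - s) * (-u * t) by ring, Real.exp_add]
    ring
  rw [e2, h, one_div, one_div, Real.inv_rpow hr.le, ← Real.rpow_neg hr.le]
  field_simp

end Hypergeometric

/-! ### Feynman parametrisation and the convolution of the weights. -/

section Feynman

open ProbabilityTheory (beta beta_pos)

theorem lintegral_rpow_mul_exp_neg_mul {a r : ℝ} (ha : 0 < a) (hr : 0 < r) :
    ∫⁻ t in Ioi (0 : ℝ), ENNReal.ofReal (t ^ (a - 1) * Real.exp (-(r * t))) =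
      ENNReal.ofReal (r ^ (-a) * Real.Gamma a) := by
  have h := Real.integral_rpow_mul_exp_neg_mul_Ioi ha hr
  have hpos : 0 < r ^ (-a) * Real.Gamma a := mul_pos (by positivity) (Real.Gamma_pos_of_pos ha)
  rw [one_div, Real.inv_rpow hr.le, ← Real.rpow_neg hr.le] at h
  rw [← h, ofReal_integral_eq_lintegral_ofReal]
  · exact not_imp_comm.1 integral_undef (h ▸ hpos.ne')
  · refine (ae_restrict_iff' measurableSet_Ioi).2 (Eventually.of_forall fun t ht => ?_)
    exact mul_nonneg (Real.rpow_nonneg (le_of_lt ht) _) (Real.exp_pos _).le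

theorem lintegral_exp_neg_mul_sq_norm (d : ℕ) {b : ℝ} (hb : 0 < b) :
    ∫⁻ v : Rd d, ENNReal.ofReal (Real.exp (-b * ‖v‖ ^ 2)) =
      ENNReal.ofReal ((Real.pi / b) ^ ((d : ℝ) / 2)) := by
  have h := GaussianFourier.integral_rexp_neg_mul_sq_norm (V := Rd d) hb
  rw [finrank_euclideanSpace, Fintype.card_fin] at h
  rw [← h, ofReal_integral_eq_lintegral_ofReal]
  · refine not_imp_comm.1 integral_undef (h ▸ ?_)
    positivity
  · exact Eventually.of_forall fun t => (Real.exp_pos _).le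

/-- The power is written as a Gamma integral of Gaussians and the order of integration is exchanged.
-/
theorem lintegral_add_sq_norm_rpow_neg (d : ℕ) {c N : ℝ} (hc : 0 < c) (hN : (d : ℝ) / 2 < N) :
    ∫⁻ v : Rd d, ENNReal.ofReal ((c + ‖v‖ ^ 2) ^ (-N)) =
      ENNReal.ofReal (Real.pi ^ ((d : ℝ) / 2) * Real.Gamma (N - d / 2) / Real.Gamma N *
        c ^ (-(N - d / 2))) := by
  have hN0 : 0 < N := lt_of_le_of_lt (by positivity) hN
  have hG := Real.Gamma_pos_of_pos hN0
  have e1 : ∀ v : Rd d, ENNReal.ofReal ((c + ‖v‖ ^ 2) ^ (-N)) = ENNReal.ofReal (Real.Gamma N)⁻¹ *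
      ∫⁻ t in Ioi (0 : ℝ), ENNReal.ofReal (t ^ (N - 1) * Real.exp (-((c + ‖v‖ ^ 2) * t))) := by
    intro v
    rw [lintegral_rpow_mul_exp_neg_mul hN0 (by positivity), ← ENNReal.ofReal_mul (by positivity)]
    congr 1
    field_simp
  simp_rw [e1]
  rw [lintegral_const_mul' _ _ ENNReal.ofReal_ne_top, lintegral_lintegral_swap]
  · have e2 : ∀ t ∈ Ioi (0 : ℝ), ∫⁻ v : Rd d, ENNReal.ofReal (t ^ (N - 1) *
        Real.exp (-((c + ‖v‖ ^ 2) * t))) = ENNReal.ofReal (Real.pi ^ ((d : ℝ) / 2)) *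
        ENNReal.ofReal (t ^ (N - d / 2 - 1) * Real.exp (-(c * t))) := by
      intro t ht
      have ht' : 0 < t := ht
      have e3 : ∀ v : Rd d, ENNReal.ofReal (t ^ (N - 1) * Real.exp (-((c + ‖v‖ ^ 2) * t))) =
          ENNReal.ofReal (t ^ (N - 1) * Real.exp (-(c * t))) *
            ENNReal.ofReal (Real.exp (-t * ‖v‖ ^ 2)) := by
        intro v
        rw [← ENNReal.ofReal_mul (by positivity), mul_assoc, ← Real.exp_add]
        congr 3
        ring
      simp_rw [e3]
      rw [lintegral_const_mul' _ _ ENNReal.ofReal_ne_top, lintegral_exp_neg_mul_sq_norm d ht',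
        ← ENNReal.ofReal_mul (by positivity), ← ENNReal.ofReal_mul (by positivity)]
      congr 1
      rw [Real.div_rpow Real.pi_pos.le ht'.le, show N - d / 2 - 1 = (N - 1) - d / 2 by ring,
        Real.rpow_sub ht' (N - 1)]
      ring
    rw [setLIntegral_congr_fun measurableSet_Ioi e2, lintegral_const_mul' _ _ ENNReal.ofReal_ne_top,
      lintegral_rpow_mul_exp_neg_mul (by linarith) hc, ← ENNReal.ofReal_mul (by positivity),
      ← ENNReal.ofReal_mul (by positivity)]
    congr 1
    field_simp
  · refine Measurable.aemeasurable ?_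
    unfold Function.uncurry
    fun_prop

/-- Feynman's parametrisation of `1 / (A^m B^n)`. -/
theorem lintegral_feynman {m n A B : ℝ} (hm : 0 < m) (hn : 0 < n) (hA : 0 < A) (hB : 0 < B) :
    ∫⁻ s in Ioo (0 : ℝ) 1, ENNReal.ofReal (betaWeight m n s * (s * A + (1 - s) * B) ^ (-(m + n))) =
      ENNReal.ofReal (beta m n * (A ^ (-m) * B ^ (-n))) := by
  set D : ℝ → ℝ := fun s => s * A + (1 - s) * B with hD
  have hDpos : ∀ s ∈ Ioo (0 : ℝ) 1, 0 < D s := fun s hs =>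
    add_pos (mul_pos hs.1 hA) (mul_pos (sub_pos.2 hs.2) hB)
  -- This Möbius map of `(0,1)` onto itself, with derivative `AB/D²`, pulls the Beta integral back
  -- to the Feynman integral.
  set φ : ℝ → ℝ := fun s => s * A / D s with hφ
  have hφ1 : ∀ s ∈ Ioo (0 : ℝ) 1, 1 - φ s = (1 - s) * B / D s := by
    intro s hs
    have := (hDpos s hs).ne'
    simp only [hφ]
    field_simp
    simp only [hD]; ring
  have hder : ∀ s ∈ Ioo (0 : ℝ) 1, HasDerivWithinAt φ (A * B / D s ^ 2) (Ioo 0 1) s := by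
    intro s hs
    have h0 := (hDpos s hs).ne'
    have h1 : HasDerivAt (fun s : ℝ => s * A) A s := by simpa using (hasDerivAt_id s).mul_const A
    have h2 : HasDerivAt D (A - B) s := by
      have := h1.add (((hasDerivAt_id s).const_sub 1).mul_const B)
      convert! this using 1
      ring
    have := h1.div h2 h0
    refine this.hasDerivWithinAt.congr_deriv ?_
    congr 1
    simp only [hD]; ring
  have hinj : InjOn φ (Ioo 0 1) := by
    intro s hs t ht hst
    have h1 := (hDpos s hs).ne'
    have h2 := (hDpos t ht).ne'
    simp only [hφ] at hst
    rw [div_eq_div_iff h1 h2] at hst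
    simp only [hD] at hst
    have : A * B * (s - t) = 0 := by linear_combination hst
    have hAB := (mul_pos hA hB).ne'
    exact sub_eq_zero.1 ((mul_eq_zero.1 this).resolve_left hAB)
  have himg : φ '' Ioo 0 1 = Ioo 0 1 := by
    apply Subset.antisymm
    · rintro _ ⟨s, hs, rfl⟩
      have h0 := hDpos s hs
      refine ⟨div_pos (mul_pos hs.1 hA) h0, ?_⟩
      have h1 := hφ1 s hs
      have : 0 < (1 - s) * B / D s := div_pos (mul_pos (sub_pos.2 hs.2) hB) h0
      linarith
    · intro t ht
      have ht1 : 0 < 1 - t := sub_pos.2 ht.2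
      have hp : 0 < t * B + (1 - t) * A := add_pos (mul_pos ht.1 hB) (mul_pos ht1 hA)
      refine ⟨t * B / (t * B + (1 - t) * A), ⟨div_pos (mul_pos ht.1 hB) hp, ?_⟩, ?_⟩
      · rw [div_lt_one hp]; nlinarith [mul_pos ht1 hA]
      · simp only [hφ, hD]
        have : t * B / (t * B + (1 - t) * A) * A + (1 - t * B / (t * B + (1 - t) * A)) * B =
            A * B / (t * B + (1 - t) * A) := by field_simp; ring
        rw [this]
        field_simp
  have hcv := lintegral_image_eq_lintegral_abs_deriv_mul measurableSet_Ioo hder hinj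
    (fun t => ENNReal.ofReal (betaWeight m n t))
  rw [himg, lintegral_betaWeight hm hn] at hcv
  have e : ∀ s ∈ Ioo (0 : ℝ) 1, ENNReal.ofReal |A * B / D s ^ 2| * ENNReal.ofReal (betaWeight m n (φ s)) =
      ENNReal.ofReal (A ^ m * B ^ n) * ENNReal.ofReal (betaWeight m n s * D s ^ (-(m + n))) := by
    intro s hs
    have h0 := hDpos s hs
    have hs0 := hs.1
    have hs1 : 0 < 1 - s := sub_pos.2 hs.2
    rw [← ENNReal.ofReal_mul (abs_nonneg _), ← ENNReal.ofReal_mul (by positivity), abs_of_pos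
      (by positivity), betaWeight, hφ1 s hs, betaWeight]
    congr 1
    simp only [hφ]
    rw [Real.div_rpow (by positivity) h0.le, Real.div_rpow (by positivity) h0.le,
      Real.mul_rpow hs0.le hA.le, Real.mul_rpow hs1.le hB.le, Real.rpow_sub_one hA.ne',
      Real.rpow_sub_one hB.ne', Real.rpow_sub_one h0.ne', Real.rpow_sub_one h0.ne', neg_add,
      Real.rpow_add h0, Real.rpow_neg h0.le, Real.rpow_neg h0.le]
    have := (Real.rpow_pos_of_pos h0 m).ne'
    have := (Real.rpow_pos_of_pos h0 n).ne'
    field_simp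
  rw [setLIntegral_congr_fun measurableSet_Ioo e, lintegral_const_mul' _ _ ENNReal.ofReal_ne_top] at hcv
  have h5 : ENNReal.ofReal (A ^ (-m) * B ^ (-n)) * ENNReal.ofReal (A ^ m * B ^ n) = 1 := by
    rw [← ENNReal.ofReal_mul (by positivity), Real.rpow_neg hA.le, Real.rpow_neg hB.le]
    rw [show (A ^ m)⁻¹ * (B ^ n)⁻¹ * (A ^ m * B ^ n) = 1 by field_simp, ENNReal.ofReal_one]
  rw [ENNReal.ofReal_mul (beta_pos hm hn).le, hcv, mul_comm, ← mul_assoc, h5, one_mul]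

theorem integrableOn_eulerIntegrand {m n α u : ℝ} (hm : 0 < m) (hn : 0 < n) (hα : 0 ≤ α) (hu : 0 ≤ u) :
    IntegrableOn (fun s => betaWeight m n s * (1 + 4 * s * (1 - s) * u) ^ (-α)) (Ioo 0 1) := by
  refine (integrableOn_betaWeight hm hn).mono' ?_ ?_
  · have := measurable_betaWeight m n
    exact Measurable.aestronglyMeasurable (by fun_prop)
  · refine (ae_restrict_iff' measurableSet_Ioo).2 (Eventually.of_forall fun s hs => ?_)
    have h1 := one_le_one_add_four_mul hs hu
    rw [norm_mul, Real.norm_of_nonneg (betaWeight_nonneg m n hs),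
      Real.norm_of_nonneg (Real.rpow_nonneg (zero_le_one.trans h1) _)]
    exact mul_le_of_le_one_right (betaWeight_nonneg m n hs)
      (Real.rpow_le_one_of_one_le_of_nonpos h1 (neg_nonpos.2 hα))

/-- Completing the square in `p`: after a translation the momentum integral is radial, and `k`
enters only through `u = |k|²/4`. -/
theorem norm_sq_feynman {d : ℕ} (k p : Rd d) (s : ℝ) :
    s * (1 + ‖p‖ ^ 2) + (1 - s) * (1 + ‖k - p‖ ^ 2) =
      1 + 4 * s * (1 - s) * (‖k‖ ^ 2 / 4) + ‖p - (1 - s) • k‖ ^ 2 := by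
  rw [norm_sub_sq_real, norm_sub_sq_real, norm_smul, inner_smul_right, real_inner_comm p k, mul_pow,
    Real.norm_eq_abs, sq_abs]
  ring

theorem lintegral_sobolevWeights (d : ℕ) {m n : ℝ} (hm : 0 < m) (hn : 0 < n) (hN : (d : ℝ) / 2 < m + n)
    (k : Rd d) :
    ∫⁻ p : Rd d, ENNReal.ofReal ((1 + ‖p‖ ^ 2) ^ (-m) * (1 + ‖k - p‖ ^ 2) ^ (-n)) =
      ENNReal.ofReal (Real.pi ^ ((d : ℝ) / 2) * Real.Gamma (m + n - d / 2) / Real.Gamma (m + n) *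
        ((beta m n)⁻¹ * eulerIntegral m n (m + n - d / 2) (‖k‖ ^ 2 / 4))) := by
  have hb := beta_pos hm hn
  have hu : 0 ≤ ‖k‖ ^ 2 / 4 := by positivity
  have hG1 := Real.Gamma_pos_of_pos (add_pos hm hn)
  have hG2 := Real.Gamma_pos_of_pos (sub_pos.2 hN)
  have e1 : ∀ p : Rd d, ENNReal.ofReal ((1 + ‖p‖ ^ 2) ^ (-m) * (1 + ‖k - p‖ ^ 2) ^ (-n)) =
      ENNReal.ofReal (beta m n)⁻¹ * ∫⁻ s in Ioo (0 : ℝ) 1, ENNReal.ofReal (betaWeight m n s *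
        (1 + 4 * s * (1 - s) * (‖k‖ ^ 2 / 4) + ‖p - (1 - s) • k‖ ^ 2) ^ (-(m + n))) := by
    intro p
    simp_rw [← norm_sq_feynman]
    rw [lintegral_feynman hm hn (by positivity) (by positivity), ← ENNReal.ofReal_mul (by positivity),
      ← mul_assoc, inv_mul_cancel₀ hb.ne', one_mul]
  simp_rw [e1]
  rw [lintegral_const_mul' _ _ ENNReal.ofReal_ne_top, lintegral_lintegral_swap]
  · have e2 : ∀ s ∈ Ioo (0 : ℝ) 1, ∫⁻ p : Rd d, ENNReal.ofReal (betaWeight m n s *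
        (1 + 4 * s * (1 - s) * (‖k‖ ^ 2 / 4) + ‖p - (1 - s) • k‖ ^ 2) ^ (-(m + n))) =
        ENNReal.ofReal (Real.pi ^ ((d : ℝ) / 2) * Real.Gamma (m + n - d / 2) / Real.Gamma (m + n)) *
        ENNReal.ofReal (betaWeight m n s *
          (1 + 4 * s * (1 - s) * (‖k‖ ^ 2 / 4)) ^ (-(m + n - d / 2))) := by
      intro s hs
      have h1 := one_le_one_add_four_mul hs hu
      have hw := betaWeight_nonneg m n hs
      simp_rw [ENNReal.ofReal_mul hw]
      rw [lintegral_const_mul' _ _ ENNReal.ofReal_ne_top,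
        lintegral_sub_right_eq_self (fun p : Rd d => ENNReal.ofReal
          ((1 + 4 * s * (1 - s) * (‖k‖ ^ 2 / 4) + ‖p‖ ^ 2) ^ (-(m + n)))),
        lintegral_add_sq_norm_rpow_neg d (by linarith) hN, ENNReal.ofReal_mul (by positivity)]
      ring
    rw [setLIntegral_congr_fun measurableSet_Ioo e2, lintegral_const_mul' _ _ ENNReal.ofReal_ne_top,
      ← ofReal_integral_eq_lintegral_ofReal (integrableOn_eulerIntegrand hm hn (by linarith) hu),
      ← eulerIntegral, ← ENNReal.ofReal_mul (by positivity), ← ENNReal.ofReal_mul (by positivity)]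
    · congr 1
      ring
    · refine (ae_restrict_iff' measurableSet_Ioo).2 (Eventually.of_forall fun s hs => ?_)
      exact mul_nonneg (betaWeight_nonneg m n hs)
        (Real.rpow_nonneg (zero_le_one.trans (one_le_one_add_four_mul hs hu)) _)
  · refine Measurable.aemeasurable ?_
    have := measurable_betaWeight m n
    unfold Function.uncurry
    fun_prop

theorem SFun_eq {l m n : ℝ} {d : ℕ} (hm : 0 < m) (hn : 0 < n) (hN : (d : ℝ) / 2 < m + n) {u : ℝ}
    (hu : 0 ≤ u) :
    SFun l m n d u = Real.Gamma (m + n - d / 2) / ((4 * Real.pi) ^ ((d : ℝ) / 2) * Real.Gamma (m + n)) *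
      (1 + 4 * u) ^ l * ((beta m n)⁻¹ * eulerIntegral m n (m + n - d / 2) u) := by
  rw [SFun, hypF, hyp3F2_eq_eulerIntegral hm hn (sub_pos.2 hN) hu]

theorem sobolevWeight_convolution_eq_SFun (d : ℕ) {l m n : ℝ} (hm : 0 < m) (hn : 0 < n)
    (hN : (d : ℝ) / 2 < m + n) (k : Rd d) :
    ENNReal.ofReal ((2 * Real.pi) ^ (-(d : ℝ)) * (1 + ‖k‖ ^ 2) ^ l) *
      (∫⁻ p : Rd d, ENNReal.ofReal ((1 + ‖p‖ ^ 2) ^ (-m) * (1 + ‖k - p‖ ^ 2) ^ (-n))) =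
        ENNReal.ofReal (SFun l m n d (‖k‖ ^ 2 / 4)) := by
  rw [lintegral_sobolevWeights d hm hn hN, ← ENNReal.ofReal_mul (by positivity),
    SFun_eq hm hn hN (by positivity)]
  congr 1
  have h1 : (2 * Real.pi) ^ (-(d : ℝ)) * Real.pi ^ ((d : ℝ) / 2) = ((4 * Real.pi) ^ ((d : ℝ) / 2))⁻¹ := by
    have h2 : (2 * Real.pi) ^ (d : ℝ) = (4 * Real.pi) ^ ((d : ℝ) / 2) * Real.pi ^ ((d : ℝ) / 2) := by
      rw [← Real.mul_rpow (by positivity) (by positivity),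
        show 4 * Real.pi * Real.pi = (2 * Real.pi) ^ (2 : ℝ) by norm_num; ring,
        ← Real.rpow_mul (by positivity)]
      congr 1
      ring
    rw [Real.rpow_neg (by positivity), h2]
    field_simp
  rw [show 1 + 4 * (‖k‖ ^ 2 / 4) = 1 + ‖k‖ ^ 2 by ring]
  rw [div_eq_mul_inv _ (_ * _), mul_inv, ← h1]
  ring

theorem upperK_mem_multConstants {l m n : ℝ} {d : ℕ} (hl : 0 ≤ l) (hm : 0 < m) (hn : 0 < n)
    (hN : (d : ℝ) / 2 < m + n) (hbdd : BddAbove (SFun l m n d '' Ici 0)) :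
    upperK l m n d ∈ multConstants l m n d := by
  refine mem_multConstants_of_bound hl (Real.sqrt_nonneg _) fun k => ?_
  rw [sobolevWeight_convolution_eq_SFun d hm hn hN]
  have h1 : ∀ u : ℝ, 0 ≤ u → SFun l m n d u ≤ sSup (SFun l m n d '' Ici 0) := fun u hu =>
    le_csSup hbdd ⟨u, hu, rfl⟩
  refine ENNReal.ofReal_le_ofReal ?_
  -- The split avoids proving `𝒮 ≥ 0`: if the supremum were negative, any square would bound the
  -- values.
  by_cases h : 0 ≤ sSup (SFun l m n d '' Ici 0)
  · rw [upperK, Real.sq_sqrt h]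
    exact h1 _ (by positivity)
  · exact ((h1 _ (by positivity)).trans (not_le.1 h).le).trans (sq_nonneg _)

end Feynman

/-! ### Calculus of quantities `1 + O(1/ℓ)`. -/

section OneAddO

/-- `f = 1 + O(1/ℓ)` as `ℓ → +∞`. -/
def OneAddBigO (f : ℝ → ℝ) : Prop :=
  (fun l : ℝ => f l - 1) =O[atTop] fun l : ℝ => 1 / l

theorem oneAddBigO_of_abs_le {f : ℝ → ℝ} {C : ℝ} (h : ∀ᶠ l : ℝ in atTop, |f l - 1| ≤ C / l) :
    OneAddBigO f := by
  refine IsBigO.of_bound C ?_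
  filter_upwards [h, eventually_gt_atTop 0] with l hl hl0
  rwa [Real.norm_eq_abs, Real.norm_of_nonneg (by positivity), mul_one_div]

theorem OneAddBigO.congr' {f g : ℝ → ℝ} (hf : OneAddBigO f) (h : f =ᶠ[atTop] g) : OneAddBigO g :=
  IsBigO.congr' hf (h.mono fun l hl => by simp only [hl]) EventuallyEq.rfl

theorem isBigO_one_div_one : (fun l : ℝ => 1 / l) =O[atTop] fun _ : ℝ => (1 : ℝ) := by
  refine IsBigO.of_bound 1 ?_
  filter_upwards [eventually_ge_atTop 1] with l hl
  rw [Real.norm_of_nonneg (by positivity), norm_one, mul_one]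
  exact (div_le_one (by linarith)).2 hl

theorem OneAddBigO.mul {f g : ℝ → ℝ} (hf : OneAddBigO f) (hg : OneAddBigO g) :
    OneAddBigO fun l => f l * g l := by
  have h1 : (fun l : ℝ => (f l - 1) * (g l - 1)) =O[atTop] fun l : ℝ => 1 / l := by
    simpa using IsBigO.mul hf (hg.trans isBigO_one_div_one)
  refine ((h1.add hf).add hg).congr_left fun l => ?_
  ring

/-- Uses `|√x - 1| ≤ |x - 1|`, valid for negative `x` too because `Real.sqrt` vanishes there. -/
theorem OneAddBigO.sqrt {f : ℝ → ℝ} (hf : OneAddBigO f) : OneAddBigO fun l => Real.sqrt (f l) := by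
  refine IsBigO.trans (IsBigO.of_bound 1 (Eventually.of_forall fun l => ?_)) hf
  rw [one_mul, Real.norm_eq_abs, Real.norm_eq_abs]
  rcases le_total 0 (f l) with h | h
  · have h1 : f l - 1 = (Real.sqrt (f l) - 1) * (Real.sqrt (f l) + 1) := by
      nlinarith [Real.mul_self_sqrt h]
    have h2 := Real.sqrt_nonneg (f l)
    rw [h1, abs_mul, abs_of_nonneg (by linarith : 0 ≤ Real.sqrt (f l) + 1)]
    exact le_mul_of_one_le_right (abs_nonneg _) (by linarith)
  · simp only [Real.sqrt_eq_zero_of_nonpos h]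
    rw [abs_of_nonpos (by linarith : f l - 1 ≤ 0)]
    norm_num
    linarith

theorem OneAddBigO.comp_const_mul {f : ℝ → ℝ} (hf : OneAddBigO f) {a : ℝ} (ha : 0 < a) :
    OneAddBigO fun l => f (a * l) := by
  have ht : Tendsto (fun l : ℝ => a * l) atTop atTop := tendsto_id.const_mul_atTop ha
  refine (hf.comp_tendsto ht).trans (IsBigO.of_bound a⁻¹ (Eventually.of_forall fun l => ?_))
  simp [abs_of_pos ha, mul_comm]

theorem OneAddBigO.squeeze {f g h : ℝ → ℝ} (hf : OneAddBigO f) (hg : OneAddBigO g)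
    (h1 : ∀ᶠ l in atTop, f l ≤ h l) (h2 : ∀ᶠ l in atTop, h l ≤ g l) : OneAddBigO h := by
  have h3 := hf.norm_left.add hg.norm_left
  refine IsBigO.trans (IsBigO.of_bound 1 ?_) h3
  filter_upwards [h1, h2] with l h1 h2
  rw [one_mul, Real.norm_of_nonneg (add_nonneg (norm_nonneg _) (norm_nonneg _)), Real.norm_eq_abs,
    Real.norm_eq_abs, Real.norm_eq_abs]
  rw [abs_le]
  constructor
  · linarith [neg_abs_le (f l - 1), abs_nonneg (g l - 1)]
  · linarith [le_abs_self (g l - 1), abs_nonneg (f l - 1)]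

theorem eqOneAddBigODiv_of_mul {f g : ℝ → ℝ} (hg : ∀ᶠ l : ℝ in atTop, 0 < g l)
    (h : OneAddBigO fun l => f l * g l) : EqOneAddBigODiv f g := by
  refine ⟨fun l => f l * g l - 1, h, ?_⟩
  filter_upwards [hg] with l hl
  field_simp
  ring

theorem oneAddBigO_self_div_sub {c : ℝ} (hc : 0 ≤ c) : OneAddBigO fun x => x / (x - c) := by
  refine oneAddBigO_of_abs_le (C := 2 * c) ?_
  filter_upwards [eventually_gt_atTop (2 * c + 1)] with x hx
  have h1 : 0 < x - c := by linarith
  have h2 : 0 < x := by linarith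
  rw [show x / (x - c) - 1 = c / (x - c) by field_simp; ring, abs_of_nonneg (by positivity),
    div_le_div_iff₀ h1 h2]
  nlinarith

theorem oneAddBigO_one : OneAddBigO fun _ => 1 := by
  simpa [OneAddBigO] using isBigO_zero _ _

end OneAddO

/-! ### Asymptotics of Gamma ratios by half-integer steps. -/

section GammaRatio

/-- Log-convexity of `Γ` at the midpoint of `x` and `x + 1`. -/
theorem Real.Gamma_add_half_le {x : ℝ} (hx : 0 < x) :
    Real.Gamma (x + 1 / 2) ≤ Real.sqrt x * Real.Gamma x := by
  have hG := Real.Gamma_pos_of_pos hx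
  have h := Real.Gamma_mul_add_mul_le_rpow_Gamma_mul_rpow_Gamma hx (by linarith : 0 < x + 1)
    (by norm_num : (0 : ℝ) < 1 / 2) (by norm_num : (0 : ℝ) < 1 / 2) (by norm_num)
  rw [Real.Gamma_add_one hx.ne', ← Real.sqrt_eq_rpow, ← Real.sqrt_eq_rpow,
    Real.sqrt_mul hx.le, mul_left_comm, Real.mul_self_sqrt hG.le] at h
  convert! h using 2
  ring

theorem Real.sqrt_sub_half_mul_Gamma_le {x : ℝ} (hx : 1 / 2 < x) :
    Real.sqrt (x - 1 / 2) * Real.Gamma x ≤ Real.Gamma (x + 1 / 2) := by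
  have h0 : 0 < x - 1 / 2 := by linarith
  have h := Real.Gamma_add_half_le h0
  rw [sub_add_cancel] at h
  have h1 : Real.Gamma (x + 1 / 2) = (x - 1 / 2) * Real.Gamma (x - 1 / 2) := by
    rw [← Real.Gamma_add_one h0.ne']; congr 1; ring
  calc Real.sqrt (x - 1 / 2) * Real.Gamma x
      ≤ Real.sqrt (x - 1 / 2) * (Real.sqrt (x - 1 / 2) * Real.Gamma (x - 1 / 2)) := by gcongr
    _ = Real.Gamma (x + 1 / 2) := by rw [← mul_assoc, Real.mul_self_sqrt h0.le, h1]

/-- The two half-step inequalities trap the expression between `1` and `√(x/(x-c-1))`; composing `d`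
such steps gives the shift by `d/2`. -/
theorem oneAddBigO_Gamma_half_step {c : ℝ} (hc : 0 ≤ c) :
    OneAddBigO fun x => Real.Gamma (x - c - 1 / 2) / Real.Gamma (x - c) * x ^ (1 / 2 : ℝ) := by
  refine oneAddBigO_one.squeeze (oneAddBigO_self_div_sub (c := c + 1) (by linarith)).sqrt ?_ ?_
  · filter_upwards [eventually_gt_atTop (c + 1)] with x hx
    have h0 : 0 < x - c - 1 / 2 := by linarith
    have h1 := Real.Gamma_add_half_le h0
    rw [sub_add_cancel] at h1
    have hG := Real.Gamma_pos_of_pos (by linarith : 0 < x - c)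
    have hG' := Real.Gamma_pos_of_pos h0
    rw [← Real.sqrt_eq_rpow, div_mul_eq_mul_div, one_le_div hG, mul_comm]
    refine h1.trans (mul_le_mul_of_nonneg_right (Real.sqrt_le_sqrt ?_) hG'.le)
    linarith
  · filter_upwards [eventually_gt_atTop (c + 1)] with x hx
    have h0 : 1 / 2 < x - c - 1 / 2 := by linarith
    have h1 := Real.sqrt_sub_half_mul_Gamma_le h0
    rw [sub_add_cancel, show x - c - 1 / 2 - 1 / 2 = x - (c + 1) by ring] at h1
    have hG := Real.Gamma_pos_of_pos (by linarith : 0 < x - c)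
    have hs : 0 < Real.sqrt (x - (c + 1)) := Real.sqrt_pos.2 (by linarith)
    rw [← Real.sqrt_eq_rpow, Real.sqrt_div' _ (by linarith), div_mul_eq_mul_div, div_le_div_iff₀ hG hs]
    nlinarith [Real.sqrt_nonneg x]

theorem oneAddBigO_Gamma_ratio (d : ℕ) :
    OneAddBigO fun x => Real.Gamma (x - (d : ℝ) / 2) / Real.Gamma x * x ^ ((d : ℝ) / 2) := by
  induction d with
  | zero =>
    refine oneAddBigO_one.congr' ?_
    filter_upwards [eventually_gt_atTop 0] with x hx
    have := Real.Gamma_pos_of_pos hx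
    simp [this.ne']
  | succ d ih =>
    refine (ih.mul (oneAddBigO_Gamma_half_step (c := (d : ℝ) / 2) (by positivity))).congr' ?_
    filter_upwards [eventually_gt_atTop ((d : ℝ) / 2)] with x hx
    have hx0 : 0 < x := lt_of_le_of_lt (by positivity) hx
    have h1 := Real.Gamma_pos_of_pos hx0
    have h2 := Real.Gamma_pos_of_pos (sub_pos.2 hx)
    rw [show x - ((d + 1 : ℕ) : ℝ) / 2 = x - (d : ℝ) / 2 - 1 / 2 by push_cast; ring,
      show ((d + 1 : ℕ) : ℝ) / 2 = (d : ℝ) / 2 + 1 / 2 by push_cast; ring, Real.rpow_add hx0]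
    generalize Real.Gamma (x - (d : ℝ) / 2) = G at h2 ⊢
    field_simp

end GammaRatio

/-! ### The supremum of `Σ` and the asymptotics of the upper bound. -/

section SigmaBounds

open scoped Pointwise

open ProbabilityTheory (beta beta_pos)

/-- The mean of `(4s(1-s))^(-ℓ)` under the `Beta(2ℓ, 2ℓ)` distribution. -/
noncomputable def betaInvMoment (l : ℝ) : ℝ := 4 ^ (-l) * beta l l / beta (2 * l) (2 * l)

theorem beta_self {x : ℝ} (hx : 0 < x) :
    beta x x = Real.Gamma x / Real.Gamma (x + 1 / 2) * ((2 : ℝ) ^ (1 - 2 * x) * Real.sqrt Real.pi) := by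
  have h := Real.Gamma_mul_Gamma_add_half x
  have h1 := Real.Gamma_pos_of_pos (by linarith : 0 < 2 * x)
  have h2 := Real.Gamma_pos_of_pos (by linarith : 0 < x + 1 / 2)
  rw [beta, ← two_mul, div_mul_eq_mul_div, div_eq_div_iff h1.ne' h2.ne']
  linear_combination Real.Gamma x * h

/-- By Legendre duplication the powers of 2 cancel and a quotient of half-step Gamma ratios remains.
Its limit is `√2`; any uniform bound would do. -/
theorem betaInvMoment_le_two {l : ℝ} (hl : 1 ≤ l) : betaInvMoment l ≤ 2 := by
  have hl0 : 0 < l := by linarith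
  have h1 := Real.Gamma_pos_of_pos hl0
  have h2 := Real.Gamma_pos_of_pos (by linarith : 0 < 2 * l)
  have h3 := Real.Gamma_pos_of_pos (by linarith : 0 < l + 1 / 2)
  have h4 := Real.Gamma_pos_of_pos (by linarith : 0 < 2 * l + 1 / 2)
  have h5 : (4 : ℝ) ^ (-l) * 2 ^ (1 - 2 * l) = 2 ^ (1 - 2 * (2 * l)) := by
    rw [show (4 : ℝ) = 2 ^ (2 : ℝ) by norm_num, ← Real.rpow_mul (by norm_num),
      ← Real.rpow_add (by norm_num)]
    congr 1; ring
  have h6 : betaInvMoment l = Real.Gamma l * Real.Gamma (2 * l + 1 / 2) /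
      (Real.Gamma (l + 1 / 2) * Real.Gamma (2 * l)) := by
    rw [betaInvMoment, beta_self hl0, beta_self (by linarith : 0 < 2 * l), ← h5]
    have := Real.sqrt_pos.2 Real.pi_pos
    field_simp
  have h7 := Real.Gamma_add_half_le (by linarith : 0 < 2 * l)
  have h8 := Real.sqrt_sub_half_mul_Gamma_le (by linarith : 1 / 2 < l)
  -- Squared, this is `2l ≤ 4l - 2`, that is, `1 ≤ l`.
  have h9 : Real.sqrt (2 * l) ≤ 2 * Real.sqrt (l - 1 / 2) := by
    rw [show (2 : ℝ) = Real.sqrt (2 ^ 2) by rw [Real.sqrt_sq (by norm_num)],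
      ← Real.sqrt_mul (by norm_num)]
    refine Real.sqrt_le_sqrt ?_
    rw [Real.sqrt_sq (by norm_num)]
    linarith
  rw [h6, div_le_iff₀ (by positivity)]
  calc Real.Gamma l * Real.Gamma (2 * l + 1 / 2)
      ≤ Real.Gamma l * (2 * Real.sqrt (l - 1 / 2) * Real.Gamma (2 * l)) := by
        gcongr; exact h7.trans (by gcongr)
    _ = 2 * (Real.sqrt (l - 1 / 2) * Real.Gamma l * Real.Gamma (2 * l)) := by ring
    _ ≤ 2 * (Real.Gamma (l + 1 / 2) * Real.Gamma (2 * l)) := by gcongr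

theorem betaWeight_two_mul_mul_rpow (l : ℝ) {s : ℝ} (hs : s ∈ Ioo (0 : ℝ) 1) :
    betaWeight (2 * l) (2 * l) s * (4 * s * (1 - s)) ^ (-l) = 4 ^ (-l) * betaWeight l l s := by
  have h1 : 0 < 1 - s := sub_pos.2 hs.2
  rw [betaWeight, betaWeight, Real.mul_rpow (by linarith [hs.1]) h1.le,
    Real.mul_rpow (by norm_num) hs.1.le, show l - 1 = (2 * l - 1) + -l by ring, Real.rpow_add hs.1,
    Real.rpow_add h1]
  ring

/-- A bound on the mean of `(1 + 4s(1-s)u)^(-α)` from a pointwise one. -/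
theorem eulerIntegral_le {l α u a b : ℝ} (hl : 0 < l) (hα : 0 ≤ α) (hu : 0 ≤ u)
    (h : ∀ s ∈ Ioo (0 : ℝ) 1, (1 + 4 * s * (1 - s) * u) ^ (-α) ≤ a + b * (4 * s * (1 - s)) ^ (-l)) :
    (beta (2 * l) (2 * l))⁻¹ * eulerIntegral (2 * l) (2 * l) α u ≤ a + b * betaInvMoment l := by
  have h2l : 0 < 2 * l := by linarith
  have hb := beta_pos h2l h2l
  have i1 := integrableOn_betaWeight h2l h2l
  have i2 := integrableOn_betaWeight hl hl
  have h1 : eulerIntegral (2 * l) (2 * l) α u ≤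
      ∫ s in Ioo (0 : ℝ) 1, (a * betaWeight (2 * l) (2 * l) s + b * 4 ^ (-l) * betaWeight l l s) := by
    refine setIntegral_mono_on (integrableOn_eulerIntegrand h2l h2l hα hu)
      ((i1.const_mul a).add (i2.const_mul _)) measurableSet_Ioo fun s hs => ?_
    rw [mul_assoc b, ← betaWeight_two_mul_mul_rpow l hs]
    have := mul_le_mul_of_nonneg_left (h s hs) (betaWeight_nonneg (2 * l) (2 * l) hs)
    linarith
  rw [integral_add (i1.const_mul a) (i2.const_mul _), integral_const_mul, integral_const_mul,
    integral_betaWeight h2l h2l, integral_betaWeight hl hl] at h1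
  rw [inv_mul_le_iff₀ hb, betaInvMoment]
  refine h1.trans_eq ?_
  field_simp

theorem betaInvMoment_pos {l : ℝ} (hl : 0 < l) : 0 < betaInvMoment l := by
  have := beta_pos hl hl
  have := beta_pos (by linarith : 0 < 2 * l) (by linarith : 0 < 2 * l)
  rw [betaInvMoment]; positivity

theorem eulerMean_nonneg {l α u : ℝ} (hl : 0 < l) (hu : 0 ≤ u) :
    0 ≤ (beta (2 * l) (2 * l))⁻¹ * eulerIntegral (2 * l) (2 * l) α u := by
  have h2l : 0 < 2 * l := by linarith
  refine mul_nonneg (inv_nonneg.2 (beta_pos h2l h2l).le) ?_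
  refine setIntegral_nonneg measurableSet_Ioo fun s hs => ?_
  exact mul_nonneg (betaWeight_nonneg _ _ hs)
    (Real.rpow_nonneg (zero_le_one.trans (one_le_one_add_four_mul hs hu)) _)

theorem SigmaFun_two_two_eq {d : ℕ} {l u : ℝ} (hl : 0 < l) (hN : (d : ℝ) / 2 < 4 * l) (hu : 0 ≤ u) :
    SigmaFun 2 2 d l u = (1 + 4 * u) ^ l *
      ((beta (2 * l) (2 * l))⁻¹ * eulerIntegral (2 * l) (2 * l) (4 * l - d / 2) u) := by
  rw [SigmaFun, ← hyp3F2_eq_eulerIntegral (by linarith) (by linarith) (sub_pos.2 hN) hu]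
  congr 2 <;> ring

theorem SigmaFun_two_two_zero {d : ℕ} {l : ℝ} (hl : 0 < l) (hN : (d : ℝ) / 2 < 4 * l) :
    SigmaFun 2 2 d l 0 = 1 := by
  have h2l : 0 < 2 * l := by linarith
  rw [SigmaFun_two_two_eq hl hN le_rfl, eulerIntegral]
  simp [integral_betaWeight h2l h2l, (beta_pos h2l h2l).ne']

/-- A crude bound for finiteness only: `1 + wu ≥ (1+u)w`, and `d/6 < ℓ` makes the exponent `4ℓ -
d/2` at least `ℓ`, enough to absorb `(1+4u)^ℓ`. -/
theorem SigmaFun_two_two_le_const {d : ℕ} {l u : ℝ} (hl : 0 < l) (hN : (d : ℝ) / 2 < 3 * l) (hu : 0 ≤ u) :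
    SigmaFun 2 2 d l u ≤ 4 ^ l * betaInvMoment l := by
  rw [SigmaFun_two_two_eq hl (by linarith) hu]
  have h := eulerIntegral_le (l := l) (α := 4 * l - d / 2) (u := u) (a := 0) (b := (1 + u) ^ (-l)) hl
    (by linarith) hu ?_
  · rw [zero_add] at h
    calc _ ≤ (1 + 4 * u) ^ l * ((1 + u) ^ (-l) * betaInvMoment l) := by gcongr
      _ ≤ (4 * (1 + u)) ^ l * ((1 + u) ^ (-l) * betaInvMoment l) := by
        have := betaInvMoment_pos hl
        gcongr
        linarith
      _ = _ := by
        rw [Real.mul_rpow (by norm_num) (by linarith), Real.rpow_neg (by linarith)]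
        field_simp
  · intro s hs
    have h1 := one_le_one_add_four_mul hs hu
    have h2 := four_mul_mul_one_sub_pos hs
    have h3 := four_mul_mul_one_sub_le s
    rw [zero_add, ← Real.mul_rpow (by linarith) h2.le]
    calc (1 + 4 * s * (1 - s) * u) ^ (-(4 * l - d / 2)) ≤ (1 + 4 * s * (1 - s) * u) ^ (-l) :=
          Real.rpow_le_rpow_of_exponent_le h1 (by linarith)
      _ ≤ ((1 + u) * (4 * s * (1 - s))) ^ (-l) :=
          Real.rpow_le_rpow_of_nonpos (by positivity) (by linarith) (by linarith)

/-- Near 0 the logarithms are `4u - 8u²` and `4u - 3u²`. The factor `e^(-u²)` supplies the quadratic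
decay that beats the linear errors for small `u`. -/
theorem one_add_four_mul_le {u : ℝ} (hu : 0 ≤ u) (hu' : u ≤ 1 / 3) :
    1 + 4 * u ≤ (1 + u) ^ 4 * Real.exp (-u ^ 2) := by
  have h1 : 1 - u ^ 2 ≤ Real.exp (-u ^ 2) := by linarith [Real.add_one_le_exp (-u ^ 2)]
  have h2 : 1 + 4 * u ≤ (1 + u) ^ 4 * (1 - u ^ 2) := by
    have : (1 + u) ^ 4 * (1 - u ^ 2) - (1 + 4 * u) =
      u ^ 2 * ((5 - 4 * u - 6 * u ^ 2) + u * (4 * (1 - u ^ 2)) + u ^ 2 * (1 - u ^ 2)) := by ring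
    have h3 : u ^ 2 ≤ 1 / 3 := by nlinarith
    have h4 : 0 ≤ 5 - 4 * u - 6 * u ^ 2 := by nlinarith
    have h5 : 0 ≤ u * (4 * (1 - u ^ 2)) := mul_nonneg hu (by linarith)
    have h6 : 0 ≤ u ^ 2 * (1 - u ^ 2) := mul_nonneg (sq_nonneg u) (by linarith)
    have := mul_nonneg (sq_nonneg u) (add_nonneg (add_nonneg h4 h5) h6)
    linarith
  exact h2.trans (by gcongr)

/-- The right side is the maximum over `u` of `exp((4+d/2)u - ℓu²)`: the `4u` comes from the Beta
mean, the `du/2` from `(1+u)^(d/2)`. -/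
theorem SigmaFun_two_two_le_of_small {d : ℕ} {l u : ℝ} (hl : 1 ≤ l) (hN : (d : ℝ) / 2 < 4 * l)
    (hu : 0 ≤ u) (hu' : u ≤ 1 / 3) :
    SigmaFun 2 2 d l u ≤ Real.exp ((4 + d / 2) ^ 2 / 4 / l) := by
  have hl0 : 0 < l := by linarith
  have hd : (0 : ℝ) ≤ d := Nat.cast_nonneg d
  have h1u : 0 < 1 + u := by linarith
  set α : ℝ := 4 * l - d / 2 with hα
  have hα0 : 0 < α := by linarith
  -- `1 + wu = (1+u)((1-ρ) + ρw)`, so weighted AM–GM gives `1 + wu ≥ (1+u)w^ρ`.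
  set ρ : ℝ := u / (1 + u) with hρ
  have hρ0 : 0 ≤ ρ := by positivity
  have hρ1 : ρ ≤ 1 / 4 := by rw [hρ, div_le_iff₀ h1u]; linarith
  have hρu : ρ ≤ u := by rw [hρ, div_le_iff₀ h1u]; nlinarith
  -- Chosen so that `w^(-ρα) = (w^(-ℓ))^θ`; since `θ ≤ 4ρ ≤ 1`, Bernoulli's inequality makes this
  -- affine in `w^(-ℓ)`, whose mean is at most 2.
  set θ : ℝ := ρ * α / l with hθ
  have hθ0 : 0 ≤ θ := by positivity
  have hθ4 : θ ≤ 4 * ρ := by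
    rw [hθ, div_le_iff₀ hl0]; nlinarith
  rw [SigmaFun_two_two_eq hl0 hN hu]
  have h := eulerIntegral_le (l := l) (α := α) (u := u) (a := (1 + u) ^ (-α) * (1 - θ))
    (b := (1 + u) ^ (-α) * θ) hl0 hα0.le hu ?_
  · have hM := betaInvMoment_le_two hl
    have h2 : (beta (2 * l) (2 * l))⁻¹ * eulerIntegral (2 * l) (2 * l) α u ≤
        (1 + u) ^ (-α) * Real.exp (4 * u) := by
      refine h.trans ?_
      rw [mul_assoc, ← mul_add]
      refine mul_le_mul_of_nonneg_left ?_ (by positivity)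
      have := Real.add_one_le_exp (4 * u)
      nlinarith
    have h3 : (1 + 4 * u) ^ l ≤ (1 + u) ^ (4 * l) * Real.exp (-(l * u ^ 2)) := by
      calc (1 + 4 * u) ^ l ≤ ((1 + u) ^ 4 * Real.exp (-u ^ 2)) ^ l :=
            Real.rpow_le_rpow (by linarith) (one_add_four_mul_le hu hu') hl0.le
        _ = _ := by
          rw [Real.mul_rpow (by positivity) (Real.exp_pos _).le, ← Real.exp_mul,
            ← Real.rpow_natCast, ← Real.rpow_mul h1u.le]
          congr 2
          ring
    have h4 : (1 + u) ^ ((d : ℝ) / 2) ≤ Real.exp (d / 2 * u) := by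
      calc (1 + u) ^ ((d : ℝ) / 2) ≤ (Real.exp u) ^ ((d : ℝ) / 2) :=
            Real.rpow_le_rpow h1u.le (by linarith [Real.add_one_le_exp u]) (by positivity)
        _ = _ := by rw [← Real.exp_mul, mul_comm]
    calc _ ≤ ((1 + u) ^ (4 * l) * Real.exp (-(l * u ^ 2))) * ((1 + u) ^ (-α) * Real.exp (4 * u)) :=
          mul_le_mul h3 h2 (eulerMean_nonneg hl0 hu) (by positivity)
      _ = (1 + u) ^ ((d : ℝ) / 2) * (Real.exp (-(l * u ^ 2)) * Real.exp (4 * u)) := by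
          rw [show (d : ℝ) / 2 = 4 * l + -α by rw [hα]; ring, Real.rpow_add h1u]; ring
      _ ≤ Real.exp (d / 2 * u) * (Real.exp (-(l * u ^ 2)) * Real.exp (4 * u)) := by gcongr
      _ = Real.exp (d / 2 * u + (-(l * u ^ 2) + 4 * u)) := by rw [Real.exp_add, Real.exp_add]
      _ ≤ _ := by
          refine Real.exp_le_exp.2 ?_
          rw [le_div_iff₀ hl0]
          nlinarith [sq_nonneg (2 * l * u - (4 + (d : ℝ) / 2))]
  · intro s hs
    have h2 := four_mul_mul_one_sub_pos hs
    have h3 := four_mul_mul_one_sub_le s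
    set w := 4 * s * (1 - s) with hw
    clear_value w
    have h4 : w ^ ρ ≤ 1 - ρ * (1 - w) := by
      have := rpow_one_add_le_one_add_mul_self (s := w - 1) (by linarith) hρ0 (by linarith : ρ ≤ 1)
      rw [add_sub_cancel] at this
      linarith
    have h5 : (1 + u) * w ^ ρ ≤ 1 + w * u := by
      have : (1 + u) * (1 - ρ * (1 - w)) = 1 + w * u := by rw [hρ]; field_simp; ring
      rw [← this]; gcongr
    have h6 : (w ^ (-l)) ^ θ ≤ 1 + θ * (w ^ (-l) - 1) := by
      have hw : 0 < w ^ (-l) := by positivity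
      have := rpow_one_add_le_one_add_mul_self (s := w ^ (-l) - 1) (by linarith) hθ0
        (by linarith : θ ≤ 1)
      rwa [add_sub_cancel] at this
    calc (1 + w * u) ^ (-α) ≤ ((1 + u) * w ^ ρ) ^ (-α) :=
          Real.rpow_le_rpow_of_nonpos (by positivity) h5 (by linarith)
      _ = (1 + u) ^ (-α) * (w ^ (-l)) ^ θ := by
          rw [Real.mul_rpow h1u.le (by positivity), ← Real.rpow_mul h2.le, ← Real.rpow_mul h2.le]
          congr 2
          rw [hθ]; field_simp
      _ ≤ (1 + u) ^ (-α) * (1 + θ * (w ^ (-l) - 1)) := by gcongr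
      _ = _ := by ring

/-- With `x = wu`, the left side is `w + 4x`. It is at most `7x` because `u ≥ 1/3`, and at most `1 +
4x` because `w ≤ 1`. Divided by `(1+x)³`, both bounds equal `63/64 < 197/200` at `x = 1/3`; the
first increases up to there and the second decreases after it. -/
theorem one_add_four_mul_mul_le {u w : ℝ} (hu : 1 / 3 ≤ u) (hw : 0 ≤ w) (hw1 : w ≤ 1) :
    (1 + 4 * u) * w ≤ 197 / 200 * (1 + w * u) ^ 3 := by
  set x := w * u with hx
  have hx0 : 0 ≤ x := by positivity
  have e : (1 + 4 * u) * w = w + 4 * x := by rw [hx]; ring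
  rw [e]
  rcases le_total x (1 / 3) with h | h
  · have h1 : w ≤ 3 * x := by rw [hx]; nlinarith
    have h2 : 7 * x ≤ 197 / 200 * (1 + x) ^ 3 := by
      have : 0 ≤ (1 / 3 - x) * (5 / 2 - x * (197 / 200) * (x + 10 / 3)) :=
        mul_nonneg (by linarith) (by nlinarith)
      nlinarith
    linarith
  · have h2 : 1 + 4 * x ≤ 197 / 200 * (1 + x) ^ 3 := by
      -- This is `(1+x)³` minus its tangent line at `1/3`.
      have h3 : 0 ≤ (x - 1 / 3) ^ 2 * (x + 11 / 3) := by positivity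
      nlinarith
    linarith

/-- Here `d/2 < ℓ` leaves an exponent of at least `3ℓ`, matching the cube in
`one_add_four_mul_mul_le`; the remaining `w^(-ℓ)` has mean at most 2. -/
theorem SigmaFun_two_two_le_of_large {d : ℕ} {l u : ℝ} (hl : 1 ≤ l) (hN : (d : ℝ) / 2 < l)
    (hu : 1 / 3 ≤ u) : SigmaFun 2 2 d l u ≤ 2 * (197 / 200) ^ l := by
  have hl0 : 0 < l := by linarith
  have hu0 : 0 ≤ u := by linarith
  rw [SigmaFun_two_two_eq hl0 (by linarith) hu0]
  have h := eulerIntegral_le (l := l) (α := 4 * l - d / 2) (u := u) (a := 0)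
    (b := (197 / 200) ^ l * (1 + 4 * u) ^ (-l)) hl0 (by linarith) hu0 ?_
  · rw [zero_add] at h
    have hM := betaInvMoment_le_two hl
    calc _ ≤ (1 + 4 * u) ^ l * ((197 / 200) ^ l * (1 + 4 * u) ^ (-l) * 2) := by
          exact mul_le_mul_of_nonneg_left (h.trans (by gcongr)) (by positivity)
      _ = _ := by
          rw [Real.rpow_neg (by linarith)]
          have : 0 < (1 + 4 * u) ^ l := by positivity
          field_simp
  · intro s hs
    have h1 := one_le_one_add_four_mul hs hu0
    have h2 := four_mul_mul_one_sub_pos hs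
    have h3 := four_mul_mul_one_sub_le s
    set w := 4 * s * (1 - s) with hw
    clear_value w
    have h4 := one_add_four_mul_mul_le hu h2.le h3
    have h5 : (1 + 4 * u) ^ l * w ^ l ≤ (197 / 200) ^ l * (1 + w * u) ^ (3 * l) := by
      rw [← Real.mul_rpow (by linarith) h2.le, Real.rpow_mul (by linarith), ← Real.mul_rpow
        (by norm_num) (by positivity)]
      refine Real.rpow_le_rpow (by positivity) ?_ hl0.le
      exact_mod_cast h4
    have h6 : (1 + w * u) ^ (-(4 * l - d / 2)) ≤ (1 + w * u) ^ (-(3 * l)) :=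
      Real.rpow_le_rpow_of_exponent_le h1 (by linarith)
    refine h6.trans ?_
    rw [zero_add, Real.rpow_neg (by linarith), Real.rpow_neg (by linarith), Real.rpow_neg h2.le]
    have p1 : 0 < (1 + 4 * u) ^ l := by positivity
    have p2 : 0 < w ^ l := by positivity
    have p3 : 0 < (1 + w * u) ^ (3 * l) := by positivity
    rw [mul_assoc, ← mul_inv, ← div_eq_mul_inv, inv_eq_one_div, div_le_div_iff₀ p3 (by positivity),
      one_mul]
    exact h5

theorem bddAbove_SigmaFun_two_two {d : ℕ} {l : ℝ} (hl : (d : ℝ) / 6 < l) :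
    BddAbove (SigmaFun 2 2 d l '' Ici 0) := by
  have hd : (0 : ℝ) ≤ d := Nat.cast_nonneg d
  refine ⟨4 ^ l * betaInvMoment l, ?_⟩
  rintro _ ⟨u, hu, rfl⟩
  exact SigmaFun_two_two_le_const (by linarith) (by linarith) hu

theorem oneAddBigO_sSup_SigmaFun (d : ℕ) :
    OneAddBigO fun l => sSup (SigmaFun 2 2 d l '' Ici 0) := by
  have hd : (0 : ℝ) ≤ d := Nat.cast_nonneg d
  set C : ℝ := (4 + d / 2) ^ 2 / 4 with hC
  have hC0 : 0 ≤ C := by positivity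
  have hq : ∀ᶠ l : ℝ in atTop, (197 / 200 : ℝ) ^ l < 1 / 2 :=
    (tendsto_rpow_atTop_of_base_lt_one _ (by norm_num) (by norm_num)).eventually_lt_const (by norm_num)
  refine oneAddBigO_of_abs_le (C := 2 * C) ?_
  filter_upwards [hq, eventually_ge_atTop 1, eventually_gt_atTop (d : ℝ), eventually_ge_atTop C]
    with l hq hl hld hlC
  have hl0 : 0 < l := by linarith
  have hCl : 0 ≤ C / l := by positivity
  have h1 : 1 ≤ sSup (SigmaFun 2 2 d l '' Ici 0) :=
    le_csSup (bddAbove_SigmaFun_two_two (by linarith))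
      ⟨0, self_mem_Ici, SigmaFun_two_two_zero hl0 (by linarith)⟩
  have h2 : sSup (SigmaFun 2 2 d l '' Ici 0) ≤ Real.exp (C / l) := by
    refine csSup_le ⟨_, 0, self_mem_Ici, rfl⟩ ?_
    rintro _ ⟨u, hu, rfl⟩
    rcases le_total u (1 / 3) with h | h
    · exact SigmaFun_two_two_le_of_small hl (by linarith) hu h
    · refine (SigmaFun_two_two_le_of_large hl (by linarith) h).trans ?_
      linarith [Real.one_le_exp hCl]
  have h3 := Real.abs_exp_sub_one_le (x := C / l)
    (by rw [abs_of_nonneg hCl]; exact (div_le_one hl0).2 hlC)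
  rw [abs_of_nonneg hCl] at h3
  rw [abs_of_nonneg (by linarith), mul_div_assoc]
  linarith [le_abs_self (Real.exp (C / l) - 1)]

theorem conditionS_two_two (d : ℕ) : ConditionS 2 2 d := by
  refine ⟨?_, oneAddBigO_sSup_SigmaFun d⟩
  filter_upwards [eventually_gt_atTop ((d : ℝ) / 6)] with l hl
  exact bddAbove_SigmaFun_two_two hl

theorem SFun_two_mul_eq (l : ℝ) (d : ℕ) (u : ℝ) :
    SFun l (2 * l) (2 * l) d u = Real.Gamma (4 * l - d / 2) /
      ((4 * Real.pi) ^ ((d : ℝ) / 2) * Real.Gamma (4 * l)) * SigmaFun 2 2 d l u := by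
  rw [SFun, SigmaFun, hypF, mul_assoc]
  congr 3 <;> ring_nf

theorem SFun_two_mul_image (l : ℝ) (d : ℕ) :
    SFun l (2 * l) (2 * l) d '' Ici 0 = (Real.Gamma (4 * l - d / 2) /
      ((4 * Real.pi) ^ ((d : ℝ) / 2) * Real.Gamma (4 * l))) • (SigmaFun 2 2 d l '' Ici 0) := by
  rw [← image_smul, image_image]
  exact image_congr fun u _ => SFun_two_mul_eq l d u

theorem SFun_factor_pos {l : ℝ} {d : ℕ} (hl : (d : ℝ) / 6 < l) :
    0 < Real.Gamma (4 * l - d / 2) / ((4 * Real.pi) ^ ((d : ℝ) / 2) * Real.Gamma (4 * l)) := by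
  have hd : (0 : ℝ) ≤ d := Nat.cast_nonneg d
  have h1 := Real.Gamma_pos_of_pos (by linarith : 0 < 4 * l - (d : ℝ) / 2)
  have h2 := Real.Gamma_pos_of_pos (by linarith : 0 < 4 * l)
  positivity

theorem bddAbove_SFun_two_mul {l : ℝ} {d : ℕ} (hl : (d : ℝ) / 6 < l) :
    BddAbove (SFun l (2 * l) (2 * l) d '' Ici 0) := by
  rw [SFun_two_mul_image]
  exact (bddAbove_SigmaFun_two_two hl).smul_of_nonneg (SFun_factor_pos hl).le

theorem oneAddBigO_upperK (d : ℕ) :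
    OneAddBigO fun l => upperK l (2 * l) (2 * l) d * (16 * Real.pi * l) ^ ((d : ℝ) / 4) := by
  have h1 := ((oneAddBigO_Gamma_ratio d).comp_const_mul four_pos).mul (oneAddBigO_sSup_SigmaFun d)
  refine h1.sqrt.congr' ?_
  filter_upwards [eventually_gt_atTop ((d : ℝ) / 6)] with l hl
  have hl0 : 0 < l := lt_of_le_of_lt (by positivity) hl
  rw [upperK, SFun_two_mul_image, Real.sSup_smul_of_nonneg (SFun_factor_pos hl).le, smul_eq_mul]
  have h2 : (16 * Real.pi * l) ^ ((d : ℝ) / 4) = Real.sqrt ((4 * Real.pi) ^ ((d : ℝ) / 2) *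
      (4 * l) ^ ((d : ℝ) / 2)) := by
    rw [← Real.mul_rpow (by positivity) (by positivity), Real.sqrt_eq_rpow,
      ← Real.rpow_mul (by positivity)]
    congr 1 <;> ring
  have h3 := Real.Gamma_pos_of_pos (by linarith : 0 < 4 * l)
  rw [h2, ← Real.sqrt_mul' _ (by positivity)]
  congr 1
  field_simp

end SigmaBounds

/-! ### Attainment of the sharp constant and the trial-function bound. -/

section SharpConstant

theorem sharpK_isLeast {l m n : ℝ} {d : ℕ} (h : (multConstants l m n d).Nonempty) :
    IsLeast (multConstants l m n d) (sharpK l m n d) := by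
  have hbdd : BddBelow (multConstants l m n d) := ⟨0, fun K hK => hK.1⟩
  refine ⟨⟨le_csInf h fun K hK => hK.1, fun f g hf hg => ?_⟩, fun K hK => csInf_le hbdd hK⟩
  obtain ⟨K₀, hK₀⟩ := h
  refine ⟨(hK₀.2 f g hf hg).1, ?_⟩
  rw [mul_assoc]
  have hA : 0 ≤ sobolevNorm m f * sobolevNorm n g :=
    mul_nonneg ENNReal.toReal_nonneg ENNReal.toReal_nonneg
  -- If the product of norms vanishes one cannot divide, but any admissible `K₀` already forces the
  -- left side to be nonpositive.
  rcases hA.eq_or_lt with hA | hA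
  · have := (hK₀.2 f g hf hg).2
    rw [mul_assoc, ← hA, mul_zero] at this
    rwa [← hA, mul_zero]
  · rw [← div_le_iff₀ hA]
    refine le_csInf ⟨K₀, hK₀⟩ fun K hK => ?_
    rw [div_le_iff₀ hA, ← mul_assoc]
    exact (hK.2 f g hf hg).2

theorem lowerK_le_of_mem {l m n σ τ K : ℝ} {d : ℕ} (hK : K ∈ multConstants l m n d)
    (h1 : InSobolev m (gaussianFun d σ)) (h2 : InSobolev n (gaussianFun d τ))
    (h3 : 0 < sobolevNorm m (gaussianFun d σ)) (h4 : 0 < sobolevNorm n (gaussianFun d τ)) :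
    lowerK l m n d σ τ ≤ K := by
  have h := (hK.2 _ _ h1 h2).2
  have e : (fun x => gaussianFun d σ x * gaussianFun d τ x) = gaussianFun d (σ + τ) := by
    ext x
    rw [gaussianFun, gaussianFun, gaussianFun, ← Complex.ofReal_mul, ← Real.exp_add]
    congr 2
    ring
  rw [e] at h
  rw [lowerK, div_le_iff₀ (mul_pos h3 h4), ← mul_assoc]
  exact h

end SharpConstant

/-! ### Sobolev norms of Gaussians and the lower bound. -/

section Gaussian

variable (d : ℕ)

theorem memLp_two_exp_neg_mul_sq_norm {b : ℝ} (hb : 0 < b) :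
    MemLp (fun x : Rd d => ((Real.exp (-b * ‖x‖ ^ 2) : ℝ) : ℂ)) 2 volume := by
  refine ⟨Continuous.aestronglyMeasurable (by fun_prop), ?_⟩
  have h : eLpNorm (fun x : Rd d => ((Real.exp (-b * ‖x‖ ^ 2) : ℝ) : ℂ)) 2 volume ^ 2 < ⊤ := by
    rw [eLpNorm_two_sq]
    have : ∀ x : Rd d, ‖((Real.exp (-b * ‖x‖ ^ 2) : ℝ) : ℂ)‖ₑ ^ 2 =
        ENNReal.ofReal (Real.exp (-(2 * b) * ‖x‖ ^ 2)) := by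
      intro x
      rw [← ofReal_norm, Complex.norm_real, Real.norm_of_nonneg (Real.exp_pos _).le,
        ← ENNReal.ofReal_pow (Real.exp_pos _).le, ← Real.exp_nat_mul]
      congr 2
      push_cast
      ring
    simp_rw [this]
    rw [lintegral_exp_neg_mul_sq_norm d (by positivity)]
    exact ENNReal.ofReal_lt_top
  exact (ENNReal.pow_lt_top_iff.1 h).resolve_right two_ne_zero

theorem gaussianFun_eq (σ : ℝ) :
    gaussianFun d σ = fun x => ((Real.exp (-(σ / 2) * ‖x‖ ^ 2) : ℝ) : ℂ) := by
  ext x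
  rw [gaussianFun]
  congr 3
  ring

theorem memLp_gaussianFun {σ : ℝ} (hσ : 0 < σ) : MemLp (gaussianFun d σ) 2 volume := by
  rw [gaussianFun_eq]
  exact memLp_two_exp_neg_mul_sq_norm d (by positivity)

theorem integrable_gaussianFun {σ : ℝ} (hσ : 0 < σ) : Integrable (gaussianFun d σ) := by
  have hb : (0 : ℝ) < (((σ / 2 : ℝ) : ℂ)).re := by rw [Complex.ofReal_re]; positivity
  have h := GaussianFourier.integrable_cexp_neg_mul_sq_norm_add (V := Rd d) hb 0 0
  refine h.congr (Eventually.of_forall fun x => ?_)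
  rw [gaussianFun_eq]
  push_cast
  simp

theorem fourier_gaussianFun {σ : ℝ} (hσ : 0 < σ) (w : Rd d) :
    𝓕 (gaussianFun d σ) w =
      (((2 * Real.pi / σ) ^ ((d : ℝ) / 2) * Real.exp (-(2 * Real.pi ^ 2 / σ) * ‖w‖ ^ 2) : ℝ) : ℂ) := by
  have hb : (0 : ℝ) < (((σ / 2 : ℝ) : ℂ)).re := by rw [Complex.ofReal_re]; positivity
  have h := fourier_gaussian_innerProductSpace (V := Rd d) hb w
  have e : gaussianFun d σ = fun v : Rd d => Complex.exp (-((σ / 2 : ℝ) : ℂ) * ‖v‖ ^ 2) := by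
    rw [gaussianFun_eq]
    ext x
    push_cast
    rfl
  rw [e, h, finrank_euclideanSpace, Fintype.card_fin, Complex.ofReal_mul,
    Complex.ofReal_cpow (by positivity), Complex.ofReal_exp]
  congr 1
  · congr 1
    · push_cast
      have : (σ : ℂ) ≠ 0 := by exact_mod_cast hσ.ne'
      field_simp
    · push_cast; rfl
  · congr 1
    push_cast
    have : (σ : ℂ) ≠ 0 := by exact_mod_cast hσ.ne'
    field_simp

theorem fourierL2_gaussianFun {σ : ℝ} (hσ : 0 < σ) :
    fourierL2 (gaussianFun d σ) =ᵐ[volume] fun k =>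
      ((σ ^ (-(d : ℝ) / 2) * Real.exp (-(1 / (2 * σ)) * ‖k‖ ^ 2) : ℝ) : ℂ) := by
  have h2 : MemLp (𝓕 (gaussianFun d σ)) 2 volume := by
    rw [funext (fourier_gaussianFun d hσ)]
    simp_rw [Complex.ofReal_mul]
    exact (memLp_two_exp_neg_mul_sq_norm d (by positivity)).const_mul _
  obtain ⟨hh, hae⟩ := (integrable_gaussianFun d hσ).exists_memLp_two_of_fourier h2
  filter_upwards [ae_eq_comp_const_smul hae two_pi_inv_ne_zero] with k hk
  rw [fourierL2_of_memLp hh, hk, fourier_gaussianFun d hσ, ← Complex.ofReal_mul, ← mul_assoc]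
  congr 2
  · rw [Real.div_rpow (by positivity) hσ.le, neg_div, Real.rpow_neg (by positivity),
      Real.rpow_neg (by positivity)]
    field_simp
  · congr 1
    rw [norm_smul, mul_pow, Real.norm_of_nonneg (by positivity)]
    have := Real.pi_pos
    field_simp

theorem eLpNorm_weightedFourier_gaussianFun_sq (s : ℝ) {σ : ℝ} (hσ : 0 < σ) :
    eLpNorm (weightedFourier s (gaussianFun d σ)) 2 volume ^ 2 = ENNReal.ofReal (σ ^ (-(d : ℝ))) *
      ∫⁻ k : Rd d, ENNReal.ofReal ((1 + ‖k‖ ^ 2) ^ s * Real.exp (-(1 / σ) * ‖k‖ ^ 2)) := by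
  rw [eLpNorm_weightedFourier_sq, ← lintegral_const_mul' _ _ ENNReal.ofReal_ne_top]
  refine lintegral_congr_ae ?_
  filter_upwards [fourierL2_gaussianFun d hσ] with k hk
  rw [hk, ← ofReal_norm, Complex.norm_real, Real.norm_of_nonneg (by positivity),
    ← ENNReal.ofReal_pow (by positivity), ← ENNReal.ofReal_mul (by positivity),
    ← ENNReal.ofReal_mul (by positivity), mul_pow, ← Real.exp_nat_mul,
    ← Real.rpow_natCast (σ ^ (-(d : ℝ) / 2)), ← Real.rpow_mul hσ.le]
  congr 1
  rw [show -(d : ℝ) / 2 * (2 : ℕ) = -(d : ℝ) by push_cast; ring,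
    show ((2 : ℕ) : ℝ) * (-(1 / (2 * σ)) * ‖k‖ ^ 2) = -(1 / σ) * ‖k‖ ^ 2 by push_cast; field_simp]
  ring

theorem one_add_rpow_mul_exp_le {lam x : ℝ} (hl : 0 ≤ lam) (hx : 0 ≤ x) :
    (1 + x) ^ lam * Real.exp (-(2 * lam) * x) ≤ Real.exp (-lam * x) := by
  have h : (1 + x) ^ lam ≤ Real.exp (lam * x) := by
    calc (1 + x) ^ lam ≤ (Real.exp x) ^ lam :=
          Real.rpow_le_rpow (by linarith) (by linarith [Real.add_one_le_exp x]) hl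
      _ = _ := by rw [← Real.exp_mul, mul_comm]
  calc _ ≤ Real.exp (lam * x) * Real.exp (-(2 * lam) * x) := by gcongr
    _ = _ := by rw [← Real.exp_add]; congr 1; ring

/-- From `log(1+x) ≥ x - x²/2` the relative error is at most `λx²/2`; half of the exponential decay
absorbs it at the cost of `4/λ`, so after integration the relative error is `O(1/λ)`. -/
theorem exp_le_one_add_rpow_mul_exp_add {lam x : ℝ} (hl : 0 < lam) (hx : 0 ≤ x) :
    Real.exp (-lam * x) ≤ (1 + x) ^ lam * Real.exp (-(2 * lam) * x) +
      4 / lam * Real.exp (-(lam / 2) * x) := by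
  have h1 : x - x ^ 2 / 2 ≤ Real.log (1 + x) := by
    -- The intermediate bound is `2x/(x+2)`.
    refine le_trans ?_ (Real.le_log_one_add_of_nonneg hx)
    rw [le_div_iff₀ (by linarith)]
    nlinarith [pow_nonneg hx 3]
  have h2 : Real.exp (lam * x) * (1 - lam * x ^ 2 / 2) ≤ (1 + x) ^ lam := by
    rw [Real.rpow_def_of_pos (by linarith)]
    calc _ ≤ Real.exp (lam * x) * Real.exp (-(lam * x ^ 2 / 2)) := by
          gcongr
          linarith [Real.add_one_le_exp (-(lam * x ^ 2 / 2))]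
      _ = Real.exp ((x - x ^ 2 / 2) * lam) := by rw [← Real.exp_add]; congr 1; ring
      _ ≤ _ := by gcongr
  have h3 : (lam / 2 * x) ^ 2 / 2 ≤ Real.exp (lam / 2 * x) := by
    have := Real.quadratic_le_exp_of_nonneg (x := lam / 2 * x) (by positivity)
    have h : 0 ≤ lam / 2 * x := by positivity
    linarith
  have h4 : lam * x ^ 2 / 2 * Real.exp (-lam * x) ≤ 4 / lam * Real.exp (-(lam / 2) * x) := by
    calc lam * x ^ 2 / 2 * Real.exp (-lam * x)
        = 4 / lam * ((lam / 2 * x) ^ 2 / 2) * Real.exp (-lam * x) := by field_simp; ring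
      _ ≤ 4 / lam * Real.exp (lam / 2 * x) * Real.exp (-lam * x) := by gcongr
      _ = _ := by rw [mul_assoc, ← Real.exp_add]; congr 2; ring
  have h5 : Real.exp (-lam * x) - lam * x ^ 2 / 2 * Real.exp (-lam * x) ≤
      (1 + x) ^ lam * Real.exp (-(2 * lam) * x) := by
    calc _ = Real.exp (lam * x) * (1 - lam * x ^ 2 / 2) * Real.exp (-(2 * lam) * x) := by
          rw [show -lam * x = lam * x + -(2 * lam) * x by ring, Real.exp_add]; ring
      _ ≤ _ := by gcongr
  linarith

theorem lintegral_sobolev_gaussian_le {lam : ℝ} (hl : 0 < lam) :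
    ∫⁻ k : Rd d, ENNReal.ofReal ((1 + ‖k‖ ^ 2) ^ lam * Real.exp (-(2 * lam) * ‖k‖ ^ 2)) ≤
      ENNReal.ofReal ((Real.pi / lam) ^ ((d : ℝ) / 2)) := by
  rw [← lintegral_exp_neg_mul_sq_norm d hl]
  exact lintegral_mono fun k =>
    ENNReal.ofReal_le_ofReal (one_add_rpow_mul_exp_le hl.le (sq_nonneg _))

theorem le_lintegral_sobolev_gaussian {lam : ℝ} (hl : 0 < lam) :
    ENNReal.ofReal ((Real.pi / lam) ^ ((d : ℝ) / 2) * (1 - 4 * 2 ^ ((d : ℝ) / 2) / lam)) ≤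
    ∫⁻ k : Rd d, ENNReal.ofReal ((1 + ‖k‖ ^ 2) ^ lam * Real.exp (-(2 * lam) * ‖k‖ ^ 2)) := by
  have h : ENNReal.ofReal ((Real.pi / lam) ^ ((d : ℝ) / 2)) ≤
      (∫⁻ k : Rd d, ENNReal.ofReal ((1 + ‖k‖ ^ 2) ^ lam * Real.exp (-(2 * lam) * ‖k‖ ^ 2))) +
        ENNReal.ofReal (4 / lam * (Real.pi / (lam / 2)) ^ ((d : ℝ) / 2)) := by
    rw [ENNReal.ofReal_mul (by positivity), ← lintegral_exp_neg_mul_sq_norm d hl,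
      ← lintegral_exp_neg_mul_sq_norm d (half_pos hl), ← lintegral_const_mul' _ _ ENNReal.ofReal_ne_top,
      ← lintegral_add_right _ (by fun_prop)]
    refine lintegral_mono fun k => ?_
    rw [← ENNReal.ofReal_mul (by positivity), ← ENNReal.ofReal_add (by positivity) (by positivity)]
    exact ENNReal.ofReal_le_ofReal (exp_le_one_add_rpow_mul_exp_add hl (sq_nonneg _))
  have h2 : (Real.pi / lam) ^ ((d : ℝ) / 2) * (1 - 4 * 2 ^ ((d : ℝ) / 2) / lam) =
      (Real.pi / lam) ^ ((d : ℝ) / 2) - 4 / lam * (Real.pi / (lam / 2)) ^ ((d : ℝ) / 2) := by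
    rw [show Real.pi / (lam / 2) = 2 * (Real.pi / lam) by field_simp,
      Real.mul_rpow (by norm_num) (by positivity)]
    ring
  rw [h2, ENNReal.ofReal_sub _ (by positivity)]
  exact tsub_le_iff_right.2 h

theorem sobolevNorm_sq_toReal (s : ℝ) (f : Rd d → ℂ) :
    sobolevNorm s f ^ 2 = (eLpNorm (weightedFourier s f) 2 volume ^ 2).toReal := by
  rw [sobolevNorm, ENNReal.toReal_pow]

theorem two_mul_rpow_mul_pi_div_rpow {lam : ℝ} (hl : 0 < lam) :
    (1 / (2 * lam)) ^ (-(d : ℝ)) * (Real.pi / lam) ^ ((d : ℝ) / 2) =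
      (4 * Real.pi * lam) ^ ((d : ℝ) / 2) := by
  rw [one_div, Real.inv_rpow (by positivity), Real.rpow_neg (by positivity), inv_inv,
    show (d : ℝ) = 2 * ((d : ℝ) / 2) by ring, Real.rpow_mul (by positivity), ← mul_div_assoc,
    mul_div_cancel_left₀ _ (two_ne_zero' ℝ), ← Real.mul_rpow (by positivity) (by positivity)]
  congr 1
  norm_num
  field_simp
  norm_num

theorem eLpNorm_sq_gaussianFun_le {lam : ℝ} (hl : 0 < lam) :
    eLpNorm (weightedFourier lam (gaussianFun d (1 / (2 * lam)))) 2 volume ^ 2 ≤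
      ENNReal.ofReal ((4 * Real.pi * lam) ^ ((d : ℝ) / 2)) := by
  rw [eLpNorm_weightedFourier_gaussianFun_sq d lam (by positivity), one_div_one_div,
    ← two_mul_rpow_mul_pi_div_rpow d hl, ENNReal.ofReal_mul (by positivity)]
  gcongr
  exact lintegral_sobolev_gaussian_le d hl

theorem le_eLpNorm_sq_gaussianFun {lam : ℝ} (hl : 0 < lam) :
    ENNReal.ofReal ((4 * Real.pi * lam) ^ ((d : ℝ) / 2) * (1 - 4 * 2 ^ ((d : ℝ) / 2) / lam)) ≤
      eLpNorm (weightedFourier lam (gaussianFun d (1 / (2 * lam)))) 2 volume ^ 2 := by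
  rw [eLpNorm_weightedFourier_gaussianFun_sq d lam (by positivity), one_div_one_div,
    ← two_mul_rpow_mul_pi_div_rpow d hl, mul_assoc, ENNReal.ofReal_mul (by positivity)]
  gcongr
  exact le_lintegral_sobolev_gaussian d hl

theorem inSobolev_gaussianFun {lam : ℝ} (hl : 0 < lam) :
    InSobolev lam (gaussianFun d (1 / (2 * lam))) := by
  refine ⟨memLp_gaussianFun d (by positivity), aestronglyMeasurable_weightedFourier _ _, ?_⟩
  exact (ENNReal.pow_lt_top_iff.1 ((eLpNorm_sq_gaussianFun_le d hl).trans_lt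
    ENNReal.ofReal_lt_top)).resolve_right two_ne_zero

theorem sobolevNorm_gaussianFun_sq_le {lam : ℝ} (hl : 0 < lam) :
    sobolevNorm lam (gaussianFun d (1 / (2 * lam))) ^ 2 ≤ (4 * Real.pi * lam) ^ ((d : ℝ) / 2) := by
  rw [sobolevNorm_sq_toReal]
  exact ENNReal.toReal_le_of_le_ofReal (by positivity) (eLpNorm_sq_gaussianFun_le d hl)

theorem le_sobolevNorm_gaussianFun_sq {lam : ℝ} (hl : 0 < lam) :
    (4 * Real.pi * lam) ^ ((d : ℝ) / 2) * (1 - 4 * 2 ^ ((d : ℝ) / 2) / lam) ≤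
      sobolevNorm lam (gaussianFun d (1 / (2 * lam))) ^ 2 := by
  rw [sobolevNorm_sq_toReal, ← ENNReal.ofReal_le_iff_le_toReal]
  · exact le_eLpNorm_sq_gaussianFun d hl
  · exact ((eLpNorm_sq_gaussianFun_le d hl).trans_lt ENNReal.ofReal_lt_top).ne

theorem sobolevNorm_gaussianFun_pos {lam : ℝ} (hl : 0 < lam) :
    0 < sobolevNorm lam (gaussianFun d (1 / (2 * lam))) := by
  rw [sobolevNorm]
  refine ENNReal.toReal_pos (fun h => ?_) (inSobolev_gaussianFun d hl).2.2.ne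
  have h1 := eLpNorm_weightedFourier_gaussianFun_sq d lam (σ := 1 / (2 * lam)) (by positivity)
  have h2 : ENNReal.ofReal ((Real.pi / (2 * lam)) ^ ((d : ℝ) / 2)) ≤
      ∫⁻ k : Rd d, ENNReal.ofReal ((1 + ‖k‖ ^ 2) ^ lam * Real.exp (-(2 * lam) * ‖k‖ ^ 2)) := by
    rw [← lintegral_exp_neg_mul_sq_norm d (by positivity)]
    refine lintegral_mono fun k => ENNReal.ofReal_le_ofReal ?_
    exact le_mul_of_one_le_left (Real.exp_pos _).le
      (Real.one_le_rpow (by nlinarith [sq_nonneg ‖k‖]) hl.le)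
  rw [h, zero_pow two_ne_zero, one_div_one_div, eq_comm, mul_eq_zero] at h1
  rcases h1 with h1 | h1
  · exact (ENNReal.ofReal_pos.2 (by positivity)).ne' h1
  · rw [h1, nonpos_iff_eq_zero] at h2
    exact (ENNReal.ofReal_pos.2 (by positivity)).ne' h2

theorem lowerK_two_mul_eq {l : ℝ} (hl : 0 < l) :
    lowerK l (2 * l) (2 * l) d (1 / (4 * l)) (1 / (4 * l)) =
      sobolevNorm l (gaussianFun d (1 / (2 * l))) /
        sobolevNorm (2 * l) (gaussianFun d (1 / (2 * (2 * l)))) ^ 2 := by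
  rw [lowerK, show 1 / (4 * l) + 1 / (4 * l) = 1 / (2 * l) by field_simp; norm_num,
    show 2 * (2 * l) = 4 * l by ring, sq]

theorem sqrt_le_lowerK_two_mul {l : ℝ} (hl : 0 < l) :
    Real.sqrt (1 - 4 * 2 ^ ((d : ℝ) / 2) / l) ≤
      lowerK l (2 * l) (2 * l) d (1 / (4 * l)) (1 / (4 * l)) * (16 * Real.pi * l) ^ ((d : ℝ) / 4) := by
  have hA := le_sobolevNorm_gaussianFun_sq d hl
  have hB := sobolevNorm_gaussianFun_sq_le d (by positivity : 0 < 2 * l)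
  have hA0 := sobolevNorm_gaussianFun_pos d hl
  have hB0 := sobolevNorm_gaussianFun_pos d (by positivity : 0 < 2 * l)
  rw [lowerK_two_mul_eq d hl]
  set A := sobolevNorm l (gaussianFun d (1 / (2 * l)))
  set B := sobolevNorm (2 * l) (gaussianFun d (1 / (2 * (2 * l))))
  set q := 1 - 4 * 2 ^ ((d : ℝ) / 2) / l
  have e : ((16 * Real.pi * l) ^ ((d : ℝ) / 4)) ^ 2 * (4 * Real.pi * l) ^ ((d : ℝ) / 2) =
      ((4 * Real.pi * (2 * l)) ^ ((d : ℝ) / 2)) ^ 2 := by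
    rw [← Real.rpow_natCast, ← Real.rpow_natCast, ← Real.rpow_mul (by positivity),
      ← Real.rpow_mul (by positivity),
      show (d : ℝ) / 4 * (2 : ℕ) = (d : ℝ) / 2 by push_cast; ring,
      ← Real.mul_rpow (by positivity) (by positivity),
      show (d : ℝ) / 2 * (2 : ℕ) = (2 : ℕ) * ((d : ℝ) / 2) by push_cast; ring,
      Real.rpow_mul (by positivity), Real.rpow_natCast]
    congr 1
    ring
  refine Real.sqrt_le_iff.2 ⟨by positivity, ?_⟩
  rw [mul_pow, div_pow, div_mul_eq_mul_div, le_div_iff₀ (by positivity)]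
  have hB2 : (B ^ 2) ^ 2 ≤ ((4 * Real.pi * (2 * l)) ^ ((d : ℝ) / 2)) ^ 2 :=
    pow_le_pow_left₀ (by positivity) hB 2
  -- For small `l` the lower bound `q` may be nonpositive; `Real.sqrt` then gives 0 and the claim is
  -- trivial.
  rcases le_total q 0 with hq | hq
  · exact (mul_nonpos_of_nonpos_of_nonneg hq (by positivity)).trans (by positivity)
  · calc q * (B ^ 2) ^ 2 ≤ q * ((4 * Real.pi * (2 * l)) ^ ((d : ℝ) / 2)) ^ 2 := by gcongr
      _ = ((4 * Real.pi * l) ^ ((d : ℝ) / 2) * q) * ((16 * Real.pi * l) ^ ((d : ℝ) / 4)) ^ 2 := by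
        rw [← e]; ring
      _ ≤ _ := by gcongr

end Gaussian

/-! ### The minimum of `D₂₂` and the squeeze. -/

section Main

theorem isMinOn_DFun_two_two :
    ((1 / 4, 1 / 4) ∈ DeltaSet 2 2 ∧ IsMinOn (DFun 2 2) (DeltaSet 2 2) (1 / 4, 1 / 4) ∧
      DFun 2 2 (1 / 4, 1 / 4) = 16) := by
  have h16 : DFun 2 2 (1 / 4, 1 / 4) = 16 := by norm_num [DFun]
  refine ⟨by norm_num [DeltaSet], ?_, h16⟩
  rintro ⟨x, y⟩ ⟨⟨hx0, hx1⟩, ⟨hy0, hy1⟩, hxy⟩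
  simp only at hx0 hx1 hy0 hy1 hxy
  change DFun 2 2 (1 / 4, 1 / 4) ≤ DFun 2 2 (x, y)
  rw [h16, DFun]
  simp only
  have h1 : 0 < 1 - 2 * x := by linarith
  have h2 : 0 < 1 - 2 * y := by linarith
  rw [le_div_iff₀ (by positivity)]
  -- With `t = x + y`, AM–GM on each pair of factors gives `D ≥ 4/(t(1-t)) ≥ 16`.
  have h3 : 4 * (x * y) ≤ (x + y) ^ 2 := by nlinarith [sq_nonneg (x - y)]
  have h4 : (1 - 2 * x) * (1 - 2 * y) ≤ (1 - x - y) ^ 2 := by nlinarith [sq_nonneg (x - y)]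
  have h5 : 4 * ((x + y) * (1 - x - y)) ≤ 1 := by nlinarith [sq_nonneg (1 - 2 * (x + y))]
  have h6 : 0 < (x + y) * (1 - x - y) := mul_pos (by linarith) (by linarith)
  calc 16 * (x * y * (1 - 2 * x) * (1 - 2 * y)) =
        4 * ((4 * (x * y)) * ((1 - 2 * x) * (1 - 2 * y))) := by ring
    _ ≤ 4 * ((x + y) ^ 2 * (1 - x - y) ^ 2) := by gcongr
    _ = (4 * ((x + y) * (1 - x - y))) * ((x + y) * (1 - x - y)) := by ring
    _ ≤ 1 * ((x + y) * (1 - x - y)) := by gcongr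
    _ = _ := by ring

theorem sharpK_two_mul_bounds (d : ℕ) {l : ℝ} (hl : (d : ℝ) / 6 < l) :
    IsLeast (multConstants l (2 * l) (2 * l) d) (sharpK l (2 * l) (2 * l) d) ∧
      BddAbove (SFun l (2 * l) (2 * l) d '' Set.Ici 0) ∧
      lowerK l (2 * l) (2 * l) d (1 / (4 * l)) (1 / (4 * l)) ≤ sharpK l (2 * l) (2 * l) d ∧
      sharpK l (2 * l) (2 * l) d ≤ upperK l (2 * l) (2 * l) d := by
  have hd : (0 : ℝ) ≤ d := Nat.cast_nonneg d
  have hl0 : 0 < l := by linarith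
  have hbdd := bddAbove_SFun_two_mul hl
  have hu : upperK l (2 * l) (2 * l) d ∈ multConstants l (2 * l) (2 * l) d :=
    upperK_mem_multConstants hl0.le (by linarith) (by linarith) (by linarith) hbdd
  have hleast := sharpK_isLeast ⟨_, hu⟩
  have h1 := inSobolev_gaussianFun d (by linarith : 0 < 2 * l)
  have h2 := sobolevNorm_gaussianFun_pos d (by linarith : 0 < 2 * l)
  rw [show 2 * (2 * l) = 4 * l by ring] at h1 h2
  exact ⟨hleast, hbdd, lowerK_le_of_mem hleast.1 h1 h1 h2 h2, hleast.2 hu⟩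

/-- Only the estimate from below uses Gaussians; the one from above is `lowerK ≤ sharpK ≤ upperK`.
-/
theorem oneAddBigO_lowerK (d : ℕ) :
    OneAddBigO fun l => lowerK l (2 * l) (2 * l) d (1 / (4 * l)) (1 / (4 * l)) *
      (16 * Real.pi * l) ^ ((d : ℝ) / 4) := by
  have h1 : OneAddBigO fun l : ℝ => 1 - 4 * 2 ^ ((d : ℝ) / 2) / l := by
    refine oneAddBigO_of_abs_le (C := 4 * 2 ^ ((d : ℝ) / 2)) ?_
    filter_upwards [eventually_gt_atTop 0] with l hl
    rw [sub_sub_cancel_left, abs_neg, abs_of_nonneg (by positivity)]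
  refine h1.sqrt.squeeze (oneAddBigO_upperK d) ?_ ?_
  · filter_upwards [eventually_gt_atTop 0] with l hl
    exact sqrt_le_lowerK_two_mul d hl
  · filter_upwards [eventually_gt_atTop ((d : ℝ) / 6)] with l hl
    obtain ⟨-, -, h3, h4⟩ := sharpK_two_mul_bounds d hl
    have hl0 : 0 < l := lt_of_le_of_lt (by positivity) hl
    exact mul_le_mul_of_nonneg_right (h3.trans h4) (by positivity)

theorem oneAddBigO_sharpK (d : ℕ) :
    OneAddBigO fun l => sharpK l (2 * l) (2 * l) d * (16 * Real.pi * l) ^ ((d : ℝ) / 4) := by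
  refine (oneAddBigO_lowerK d).squeeze (oneAddBigO_upperK d) ?_ ?_
  all_goals
    filter_upwards [eventually_gt_atTop ((d : ℝ) / 6)] with l hl
    obtain ⟨-, -, h3, h4⟩ := sharpK_two_mul_bounds d hl
    have hl0 : 0 < l := lt_of_le_of_lt (by positivity) hl
    have hp : 0 ≤ (16 * Real.pi * l) ^ ((d : ℝ) / 4) := by positivity
  · exact mul_le_mul_of_nonneg_right h3 hp
  · exact mul_le_mul_of_nonneg_right h4 hp

theorem eventually_sixteen_pi_rpow_pos (d : ℕ) :
    ∀ᶠ l : ℝ in atTop, 0 < (16 * Real.pi * l) ^ ((d : ℝ) / 4) := by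
  filter_upwards [eventually_gt_atTop 0] with l hl
  positivity

end Main

theorem mainTheorem1 (d : ℕ) (hd : 0 < d) :
    -- the sharp constant exists, and is bounded by the two explicit bounds
    (∀ l : ℝ, (d : ℝ) / 6 < l →
      IsLeast (multConstants l (2 * l) (2 * l) d) (sharpK l (2 * l) (2 * l) d) ∧
      BddAbove (SFun l (2 * l) (2 * l) d '' Set.Ici 0) ∧
      lowerK l (2 * l) (2 * l) d (1 / (4 * l)) (1 / (4 * l)) ≤ sharpK l (2 * l) (2 * l) d ∧
      sharpK l (2 * l) (2 * l) d ≤ upperK l (2 * l) (2 * l) d) ∧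
    -- asymptotics of the upper bound
    ConditionS 2 2 d ∧
    EqOneAddBigODiv (fun l => upperK l (2 * l) (2 * l) d)
      (fun l => (16 * Real.pi * l) ^ ((d : ℝ) / 4)) ∧
    -- asymptotics of the lower bound
    ((1 / 4, 1 / 4) ∈ DeltaSet 2 2 ∧ IsMinOn (DFun 2 2) (DeltaSet 2 2) (1 / 4, 1 / 4) ∧
      DFun 2 2 (1 / 4, 1 / 4) = 16) ∧
    EqOneAddBigODiv (fun l => lowerK l (2 * l) (2 * l) d (1 / (4 * l)) (1 / (4 * l)))
      (fun l => (16 * Real.pi * l) ^ ((d : ℝ) / 4)) ∧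
    -- asymptotics of the sharp constant
    EqOneAddBigODiv (fun l => sharpK l (2 * l) (2 * l) d)
      (fun l => (16 * Real.pi * l) ^ ((d : ℝ) / 4)) := by
  have hpos := eventually_sixteen_pi_rpow_pos d
  exact ⟨fun l hl => sharpK_two_mul_bounds d hl, conditionS_two_two d,
    eqOneAddBigODiv_of_mul hpos (oneAddBigO_upperK d), isMinOn_DFun_two_two,
    eqOneAddBigODiv_of_mul hpos (oneAddBigO_lowerK d),
    eqOneAddBigODiv_of_mul hpos (oneAddBigO_sharpK d)⟩
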